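/- Let $k$ be a field of characteristic zero, let $G$ be a finite group with identity $e$, and let $A=\bigoplus_{g\in G}A_g$ be a $G$-graded $k$-algebra which is noetherian on both sides. All modules are right modules. Call $A$ densely $G$-graded if $A_gA_{g^{-1}}\neq A_e$ for only finitely many $g\in G$ and $A_e/A_gA_{g^{-1}}$ is finite dimensional over $k$ for all $g\in G$. Let $\operatorname{Mod}A_e$ be the category of $A_e$-modules and let $\operatorname{GrMod}_GA$ be the category of $G$-graded $A$-modules $M=\bigoplus_{g\in G}M_g$ with degree-preserving $A$-linear maps. Let $\operatorname{Tor}A_e\subseteq\operatorname{Mod}A_e$ be the Serre subcategory of those modules $N$ such that $nA_e$ is finite dimensional over $k$ for all $n\in N$, and let $\operatorname{GrTor}_GA\subseteq\operatorname{GrMod}_GA$ be the Serre subcategory of those graded modules $M$ such that $mA$ is finite dimensional over $k$ for all homogeneous $m\in M$. Put $\operatorname{QMod}A_e=\operatorname{Mod}A_e/\operatorname{Tor}A_e$ and $\operatorname{QGrMod}_GA=\operatorname{GrMod}_GA/\operatorname{GrTor}_GA$, and let $(-)_e:\operatorname{QGrMod}_GA\to\operatorname{QMod}A_e$ be the functor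 induced by the exact functor $\operatorname{GrMod}_GA\to\operatorname{Mod}A_e$, $M\mapsto M_e$. Then the following are equivalent: (i) $A$ is densely $G$-graded; (ii) every finitely generated $G$-graded $A$-module $M$ with $M_e$ finite dimensional over $k$ is itself finite dimensional over $k$; (iii) the functor $(-)_e:\operatorname{QGrMod}_GA\to\operatorname{QMod}A_e$ is an equivalence of (abelian) categories. -/

import Mathlib

open CategoryTheory CategoryTheory.Limits MulOpposite

universe u v w

/-! ### Densely graded algebras -/

/-- A `G`-graded `k`-algebra `A = ⨁ A_g` (the group `G`, not assumed commutative, is written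
additively) is densely graded if `A_g A_{g⁻¹} ≠ A_e` for only finitely many `g`, and
`A_e / A_g A_{g⁻¹}` is finite dimensional for all `g`. -/
structure IsDenselyGraded {k : Type u} {A : Type v} {G : Type w} [Field k] [Ring A] [Algebra k A]
    [AddGroup G] (𝒜 : G → Submodule k A) : Prop where
  finite_ne : {g : G | 𝒜 g * 𝒜 (-g) ≠ 𝒜 0}.Finite
  finite_quotient : ∀ g : G,
    FiniteDimensional k (𝒜 0 ⧸ (𝒜 g * 𝒜 (-g)).submoduleOf (𝒜 0))

/-! ### Torsion modules -/

section Torsion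

variable (k : Type u) [Field k]

/-- Every cyclic submodule is finite dimensional over `k`. -/
def IsTorsionOver (R : Type v) [Ring R] [Algebra k R] (M : Type w) [AddCommGroup M]
    [Module k M] [Module R M] [IsScalarTower k R M] : Prop :=
  ∀ m : M, FiniteDimensional k (Submodule.span R {m})

variable {k} {R : Type v} [Ring R] [Algebra k R]

theorem finite_of_fg_of_torsion {M : Type*} [AddCommGroup M]
    [Module k M] [Module R M] [IsScalarTower k R M] (h : IsTorsionOver k R M)
    (N : Submodule R M) (hN : N.FG) : FiniteDimensional k N := by
  obtain ⟨s, rfl⟩ := hN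
  have : ((Submodule.span R (s : Set M)).restrictScalars k).FG := by
    have e : (Submodule.span R (s : Set M)).restrictScalars k
        = ⨆ m ∈ s, (Submodule.span R {m}).restrictScalars k := by
      apply le_antisymm
      · intro x hx
        rw [Submodule.restrictScalars_mem] at hx
        obtain ⟨c, rfl⟩ := Submodule.mem_span_finset'.1 hx
        refine Submodule.sum_mem _ fun i _ => ?_
        refine Submodule.mem_iSup_of_mem i.1 (Submodule.mem_iSup_of_mem i.2 ?_)
        exact Submodule.smul_mem _ _ (Submodule.mem_span_singleton_self _)
      · refine iSup₂_le fun m hm => ?_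
        exact Submodule.span_mono (by simpa using hm)
    rw [e]
    exact Submodule.fg_biSup _ _ fun m _ => Module.Finite.iff_fg.1 (h m)
  exact Module.Finite.iff_fg.2 this

theorem IsTorsionOver.of_injective {M N : Type*} [AddCommGroup M]
    [Module k M] [Module R M] [IsScalarTower k R M] [AddCommGroup N]
    [Module k N] [Module R N] [IsScalarTower k R N] (f : M →ₗ[R] N)
    (hf : Function.Injective f) (h : IsTorsionOver k R N) : IsTorsionOver k R M := by
  intro m
  have := h (f m)
  let g : Submodule.span R {m} →ₗ[R] Submodule.span R {f m} :=
    f.restrict fun x hx => by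
      obtain ⟨r, rfl⟩ := Submodule.mem_span_singleton.1 hx
      exact Submodule.mem_span_singleton.2 ⟨r, by simp⟩
  refine FiniteDimensional.of_injective (g.restrictScalars k) fun x y hxy => ?_
  exact Subtype.ext (hf (congrArg Subtype.val hxy))

theorem IsTorsionOver.of_surjective {M N : Type*} [AddCommGroup M]
    [Module k M] [Module R M] [IsScalarTower k R M] [AddCommGroup N]
    [Module k N] [Module R N] [IsScalarTower k R N] (f : M →ₗ[R] N)
    (hf : Function.Surjective f) (h : IsTorsionOver k R M) : IsTorsionOver k R N := by
  intro n
  obtain ⟨m, rfl⟩ := hf n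
  have := h m
  let g : Submodule.span R {m} →ₗ[R] Submodule.span R {f m} :=
    f.restrict fun x hx => by
      obtain ⟨r, rfl⟩ := Submodule.mem_span_singleton.1 hx
      exact Submodule.mem_span_singleton.2 ⟨r, by simp⟩
  refine Module.Finite.of_surjective (g.restrictScalars k) fun y => ?_
  obtain ⟨y, hy⟩ := y
  obtain ⟨r, rfl⟩ := Submodule.mem_span_singleton.1 hy
  exact ⟨⟨r • m, Submodule.smul_mem _ _ (Submodule.mem_span_singleton_self _)⟩,
    Subtype.ext (by simp [g])⟩

theorem IsTorsionOver.of_exact [IsNoetherianRing R] {M N P : Type*} [AddCommGroup M]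
    [Module k M] [Module R M] [IsScalarTower k R M] [AddCommGroup N]
    [Module k N] [Module R N] [IsScalarTower k R N] [AddCommGroup P]
    [Module k P] [Module R P] [IsScalarTower k R P] (f : M →ₗ[R] N) (g : N →ₗ[R] P)
    (hfg : ∀ n, g n = 0 → ∃ m, f m = n)
    (hM : IsTorsionOver k R M) (hP : IsTorsionOver k R P) : IsTorsionOver k R N := by
  intro n
  let g' : Submodule.span R {n} →ₗ[R] Submodule.span R {g n} :=
    g.restrict fun x hx => by
      obtain ⟨r, rfl⟩ := Submodule.mem_span_singleton.1 hx
      exact Submodule.mem_span_singleton.2 ⟨r, by simp⟩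
  have hker : IsTorsionOver k R (LinearMap.range f) :=
    hM.of_surjective f.rangeRestrict f.surjective_rangeRestrict
  have hker' : IsTorsionOver k R (LinearMap.ker g') := by
    let i : LinearMap.ker g' →ₗ[R] LinearMap.range f :=
      LinearMap.codRestrict _ ((Submodule.subtype _).comp (Submodule.subtype _)) (by
        rintro ⟨⟨x, hx⟩, hx'⟩
        exact hfg x (congrArg Subtype.val (LinearMap.mem_ker.1 hx')))
    refine hker.of_injective i fun x y hxy => ?_
    exact Subtype.ext (Subtype.ext (congrArg (fun z => (z.1 : N)) hxy))
  have hfin : (⊤ : Submodule R (LinearMap.ker g')).FG := by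
    have : IsNoetherian R (Submodule.span R {n}) :=
      isNoetherian_of_fg_of_noetherian _ (Submodule.fg_span_singleton n)
    exact IsNoetherian.noetherian _
  have h1 : FiniteDimensional k (⊤ : Submodule R (LinearMap.ker g')) :=
    finite_of_fg_of_torsion hker' _ hfin
  have h1' : FiniteDimensional k (LinearMap.ker (g'.restrictScalars k)) := by
    refine Module.Finite.of_surjective
      (({ toFun := fun x => ⟨x.1.1, x.1.2⟩
          map_add' := fun _ _ => rfl
          map_smul' := fun _ _ => rfl } :
        (⊤ : Submodule R (LinearMap.ker g')) →ₗ[k] LinearMap.ker (g'.restrictScalars k))) ?_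
    rintro ⟨x, hx⟩
    exact ⟨⟨⟨x, hx⟩, trivial⟩, rfl⟩
  have h2 : FiniteDimensional k (Submodule.span R {g n}) := hP (g n)
  have h2' : FiniteDimensional k (LinearMap.range (g'.restrictScalars k)) := inferInstance
  have := h2'
  refine Module.Finite.iff_fg.2 ?_ |>.equiv (Submodule.topEquiv (R := k))
  refine Submodule.fg_of_fg_map_of_fg_inf_ker (g'.restrictScalars k) ?_ ?_
  · rw [← LinearMap.range_eq_map]; exact Module.Finite.iff_fg.1 h2'
  · rw [top_inf_eq]; exact Module.Finite.iff_fg.1 h1'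

theorem IsTorsionOver.of_subsingleton (M : Type*) [AddCommGroup M] [Subsingleton M]
    [Module k M] [Module R M] [IsScalarTower k R M] : IsTorsionOver k R M :=
  fun _ => Module.Finite.of_surjective (0 : M →ₗ[k] _) fun _ => ⟨0, Subsingleton.elim _ _⟩

end Torsion

/-! ### The quotient category `QMod R` of right modules modulo torsion modules -/

section QMod

open scoped ModuleCat

variable (k : Type u) [Field k] (R : Type v) [Ring R] [Algebra k R]

/-- `Tor R`: the right `R`-modules `M` (that is, modules over `Rᵐᵒᵖ`) such that `mR` is finite
dimensional over `k` for all `m ∈ M`. -/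
def torModule : ObjectProperty (ModuleCat.{w} Rᵐᵒᵖ) :=
  fun M => ∀ m : M, FiniteDimensional k (Submodule.span Rᵐᵒᵖ {m})

instance torModule_isSerreClass [IsNoetherianRing Rᵐᵒᵖ] :
    (torModule.{u, v, w} k R).IsSerreClass where
  exists_zero := ⟨ModuleCat.of Rᵐᵒᵖ PUnit, ModuleCat.isZero_of_subsingleton _, 
    IsTorsionOver.of_subsingleton (k := k) _⟩
  prop_of_mono f _ h :=
    IsTorsionOver.of_injective (k := k) f.hom ((ModuleCat.mono_iff_injective f).1 inferInstance) h
  prop_of_epi f _ h :=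
    IsTorsionOver.of_surjective (k := k) f.hom ((ModuleCat.epi_iff_surjective f).1 inferInstance) h
  prop_X₂_of_shortExact {S} hS h₁ h₃ :=
    IsTorsionOver.of_exact (k := k) S.f.hom S.g.hom
      (fun n hn => (ShortComplex.ShortExact.moduleCat_exact_iff_function_exact S).1 hS.exact n |>.1 hn)
      h₁ h₃

/-- `QMod R = Mod R / Tor R`. -/
abbrev QMod [IsNoetherianRing Rᵐᵒᵖ] := (torModule.{u, v, w} k R).isoModSerre.Localization

end QMod

/-! ### Graded modules -/

/-- A criterion for a family of submodules to decompose a module: existence of projections. -/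
theorem isInternal_of_projections {k M G : Type*} [Field k] [AddCommGroup M] [Module k M]
    [DecidableEq G] (ℳ : G → Submodule k M) (p : G → M →ₗ[k] M)
    (h_mem : ∀ g x, p g x ∈ ℳ g) (h_self : ∀ g, ∀ x ∈ ℳ g, p g x = x)
    (h_ne : ∀ g h, g ≠ h → ∀ x ∈ ℳ h, p g x = 0)
    (h_sum : ∀ x, ∃ s : Finset G, ∀ t, s ⊆ t → ∑ g ∈ t, p g x = x) :
    DirectSum.IsInternal ℳ := by
  rw [DirectSum.isInternal_submodule_iff_iSupIndep_and_iSup_eq_top]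
  constructor
  · intro g
    rw [Submodule.disjoint_def]
    intro x hx hx'
    have : (⨆ j, ⨆ (_ : j ≠ g), ℳ j) ≤ LinearMap.ker (p g) :=
      iSup₂_le fun j hj y hy => h_ne g j hj.symm y hy
    rw [← h_self g x hx]
    exact this hx'
  · rw [eq_top_iff]
    intro x _
    obtain ⟨s, hs⟩ := h_sum x
    rw [← hs s subset_rfl]
    exact Submodule.sum_mem _ fun g _ => Submodule.mem_iSup_of_mem g (h_mem g x)

/-- A `G`-graded right `A`-module `M = ⨁ M_g`, with `M_g A_h ⊆ M_{gh}`. Right `A`-modules are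
modules over `Aᵐᵒᵖ`, so that `op a • m` is `m a`. -/
structure GrMod {k : Type u} {A : Type v} {G : Type w} [Field k] [Ring A] [Algebra k A]
    [AddGroup G] [DecidableEq G] (𝒜 : G → Submodule k A) where
  carrier : Type v
  [addCommGroup : AddCommGroup carrier]
  [moduleBase : Module k carrier]
  [module : Module Aᵐᵒᵖ carrier]
  [isScalarTower : IsScalarTower k Aᵐᵒᵖ carrier]
  component : G → Submodule k carrier
  isInternal : DirectSum.IsInternal component
  smul_mem : ∀ {g h : G} {m : carrier} {a : A},
    m ∈ component g → a ∈ 𝒜 h → op a • m ∈ component (g + h)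

namespace GrMod

variable {k : Type u} {A : Type v} {G : Type w} [Field k] [Ring A] [Algebra k A]
    [AddGroup G] [DecidableEq G] {𝒜 : G → Submodule k A}

instance : CoeSort (GrMod 𝒜) (Type v) := ⟨GrMod.carrier⟩

attribute [instance] addCommGroup moduleBase module isScalarTower

/-- Morphisms of graded modules: `A`-linear maps preserving degrees. -/
@[ext]
structure Hom (M N : GrMod 𝒜) where
  toLin : M →ₗ[Aᵐᵒᵖ] N
  map_mem : ∀ g, ∀ m ∈ M.component g, toLin m ∈ N.component g

instance : Category (GrMod 𝒜) where
  Hom := Hom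
  id M := ⟨LinearMap.id, fun _ _ h => h⟩
  comp f g := ⟨g.toLin.comp f.toLin, fun _ _ h => g.map_mem _ _ (f.map_mem _ _ h)⟩

/-- The underlying linear map of a morphism. -/
def lin {M N : GrMod 𝒜} (f : M ⟶ N) : M →ₗ[Aᵐᵒᵖ] N := Hom.toLin f

/-- Constructor for morphisms. -/
def homMk {M N : GrMod 𝒜} (f : M →ₗ[Aᵐᵒᵖ] N)
    (hf : ∀ g, ∀ m ∈ M.component g, f m ∈ N.component g) : M ⟶ N := Hom.mk f hf

@[simp] theorem lin_homMk {M N : GrMod 𝒜} (f : M →ₗ[Aᵐᵒᵖ] N) (hf) :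
    lin (homMk f hf : M ⟶ N) = f := rfl

theorem lin_mem {M N : GrMod 𝒜} (f : M ⟶ N) {g : G} {m : M} (hm : m ∈ M.component g) :
    lin f m ∈ N.component g := Hom.map_mem f g m hm

theorem lin_injective {M N : GrMod 𝒜} : Function.Injective (lin : (M ⟶ N) → _) :=
  fun _ _ h => Hom.ext h

theorem hom_ext {M N : GrMod 𝒜} {f g : M ⟶ N} (h : ∀ x, lin f x = lin g x) : f = g :=
  lin_injective (LinearMap.ext h)

@[simp] theorem lin_id (M : GrMod 𝒜) : lin (𝟙 M) = LinearMap.id := rfl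

@[simp] theorem lin_comp {M N P : GrMod 𝒜} (f : M ⟶ N) (g : N ⟶ P) :
    lin (f ≫ g) = (lin g).comp (lin f) := rfl

variable {M N : GrMod 𝒜}

instance : Zero (M ⟶ N) := ⟨homMk 0 fun _ _ _ => Submodule.zero_mem _⟩
instance : Add (M ⟶ N) :=
  ⟨fun f g => homMk (lin f + lin g) fun _ _ h => Submodule.add_mem _ (lin_mem f h) (lin_mem g h)⟩
instance : Neg (M ⟶ N) :=
  ⟨fun f => homMk (-lin f) fun _ _ h => Submodule.neg_mem _ (lin_mem f h)⟩
instance : Sub (M ⟶ N) :=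
  ⟨fun f g => homMk (lin f - lin g) fun _ _ h => Submodule.sub_mem _ (lin_mem f h) (lin_mem g h)⟩
instance : SMul ℕ (M ⟶ N) :=
  ⟨fun n f => homMk (n • lin f) fun _ _ h => nsmul_mem (lin_mem f h) n⟩
instance : SMul ℤ (M ⟶ N) :=
  ⟨fun n f => homMk (n • lin f) fun _ _ h => zsmul_mem (lin_mem f h) n⟩

instance : AddCommGroup (M ⟶ N) :=
  lin_injective.addCommGroup _ rfl (fun _ _ => rfl) (fun _ => rfl) (fun _ _ => rfl)
    (fun _ _ => rfl) (fun _ _ => rfl)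

@[simp] theorem lin_zero : lin (0 : M ⟶ N) = 0 := rfl
@[simp] theorem lin_add (f g : M ⟶ N) : lin (f + g) = lin f + lin g := rfl
@[simp] theorem lin_sub (f g : M ⟶ N) : lin (f - g) = lin f - lin g := rfl

instance : Preadditive (GrMod 𝒜) where
  add_comp _ _ _ f f' g := hom_ext fun x => by simp
  comp_add _ _ _ f g g' := hom_ext fun x => by simp

/-- The projection of a graded module onto its component of degree `g`. -/
noncomputable def proj (M : GrMod 𝒜) (g : G) : M →ₗ[k] M :=
  letI := M.isInternal.chooseDecomposition
  (M.component g).subtype ∘ₗ DirectSum.component k G (fun i => M.component i) g ∘ₗ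
    (DirectSum.decomposeLinearEquiv M.component).toLinearMap

theorem proj_mem (M : GrMod 𝒜) (g : G) (x : M) : M.proj g x ∈ M.component g :=
  Subtype.property _

theorem proj_self (M : GrMod 𝒜) {g : G} {x : M} (hx : x ∈ M.component g) : M.proj g x = x :=
  letI := M.isInternal.chooseDecomposition
  DirectSum.decompose_of_mem_same M.component hx

theorem proj_ne (M : GrMod 𝒜) {g h : G} (hgh : g ≠ h) {x : M} (hx : x ∈ M.component h) :
    M.proj g x = 0 :=
  letI := M.isInternal.chooseDecomposition
  DirectSum.decompose_of_mem_ne M.component hx hgh.symm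

theorem proj_sum (M : GrMod 𝒜) (x : M) :
    ∃ s : Finset G, ∀ t, s ⊆ t → ∑ g ∈ t, M.proj g x = x := by
  classical
  let := M.isInternal.chooseDecomposition
  refine ⟨(DirectSum.decompose M.component x).support, fun t ht => ?_⟩
  conv_rhs => rw [← DirectSum.sum_support_decompose M.component x]
  refine (Finset.sum_subset ht fun g _ hg => ?_).symm
  have := DFinsupp.notMem_support_iff.1 hg
  change ((DirectSum.decompose M.component x g : M.component g) : M) = 0
  rw [this]; rfl

theorem lin_proj (f : M ⟶ N) (g : G) (x : M) : lin f (M.proj g x) = N.proj g (lin f x) := by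
  obtain ⟨s, hs⟩ := M.proj_sum x
  have ht := hs (insert g s) (Finset.subset_insert _ _)
  conv_rhs => rw [← ht, map_sum, map_sum]
  rw [Finset.sum_eq_single g]
  · rw [proj_self _ (lin_mem f (M.proj_mem g x))]
  · intro h _ hne
    exact proj_ne _ hne.symm (lin_mem f (M.proj_mem h x))
  · intro h; exact absurd (Finset.mem_insert_self _ _) h

/-! #### Kernels, cokernels and finite products -/

/-- The kernel of a morphism with the induced grading. -/
@[reducible] noncomputable def ker (f : M ⟶ N) : GrMod 𝒜 where
  carrier := LinearMap.ker (lin f)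
  component g := (M.component g).comap ((LinearMap.ker (lin f)).subtype.restrictScalars k)
  isInternal := by
    refine isInternal_of_projections _
      (fun g =>
        { toFun := fun x => ⟨M.proj g x.1, by
            rw [LinearMap.mem_ker, lin_proj, LinearMap.mem_ker.1 x.2, map_zero]⟩
          map_add' := fun x y => Subtype.ext (map_add (M.proj g) x.1 y.1)
          map_smul' := fun c x => Subtype.ext (map_smul (M.proj g) c x.1) })
      (fun g x => M.proj_mem g x.1) (fun g x hx => Subtype.ext (M.proj_self hx))
      (fun g h hgh x hx => Subtype.ext (M.proj_ne hgh hx)) fun x => ?_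
    obtain ⟨s, hs⟩ := M.proj_sum x.1
    exact ⟨s, fun t ht => Subtype.ext (by
      rw [AddSubmonoidClass.coe_finsetSum]; exact hs t ht)⟩
  smul_mem hm ha := M.smul_mem hm ha

/-- The inclusion of the kernel. -/
noncomputable def kerι (f : M ⟶ N) : ker f ⟶ M :=
  homMk (LinearMap.ker (lin f)).subtype fun _ _ h => h

theorem kerι_comp (f : M ⟶ N) : kerι f ≫ f = 0 := hom_ext fun x => x.2

/-- The kernel is a kernel in the categorical sense. -/
noncomputable def kerIsLimit (f : M ⟶ N) : IsLimit (KernelFork.ofι (kerι f) (kerι_comp f)) :=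
  KernelFork.IsLimit.ofι _ _
    (fun s hs => homMk ((lin s).codRestrict _ fun c => LinearMap.mem_ker.2
      (by simpa using congrArg (fun t => lin t c) hs)) fun _ _ h => lin_mem s h)
    (fun _ _ => rfl)
    (fun s hs m hm => hom_ext fun x => Subtype.ext (congrArg (fun t => lin t x) hm))

/-- The cokernel of a morphism with the induced grading. -/
@[reducible] noncomputable def coker (f : M ⟶ N) : GrMod 𝒜 where
  carrier := N ⧸ LinearMap.range (lin f)
  component g := (N.component g).map ((LinearMap.range (lin f)).mkQ.restrictScalars k)
  isInternal := by
    let R := (LinearMap.range (lin f)).restrictScalars k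
    have hR : ∀ g, R ≤ R.comap (N.proj g) := by
      rintro g _ ⟨y, rfl⟩
      exact ⟨M.proj g y, lin_proj f g y⟩
    let p : G → (N ⧸ LinearMap.range (lin f)) →ₗ[k] (N ⧸ LinearMap.range (lin f)) := fun g =>
      { toFun := R.mapQ R (N.proj g) (hR g)
        map_add' := map_add (R.mapQ R (N.proj g) (hR g))
        map_smul' := by
          rintro c ⟨x⟩
          exact map_smul (R.mapQ R (N.proj g) (hR g)) c (R.mkQ x) }
    have hp : ∀ g (x : N), p g ((LinearMap.range (lin f)).mkQ x) =
      (LinearMap.range (lin f)).mkQ (N.proj g x) := fun _ _ => rfl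
    refine isInternal_of_projections _ p ?_ ?_ ?_ ?_
    · rintro g ⟨x⟩
      exact ⟨N.proj g x, N.proj_mem g x, rfl⟩
    · rintro g _ ⟨x, hx, rfl⟩
      exact (hp g x).trans (congrArg _ (N.proj_self hx))
    · rintro g h hgh _ ⟨x, hx, rfl⟩
      exact (hp g x).trans ((congrArg _ (N.proj_ne hgh hx)).trans (map_zero _))
    · rintro ⟨x⟩
      obtain ⟨s, hs⟩ := N.proj_sum x
      refine ⟨s, fun t ht => ?_⟩
      change ∑ g ∈ t, p g ((LinearMap.range (lin f)).mkQ x) = (LinearMap.range (lin f)).mkQ x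
      conv_rhs => rw [← hs t ht, map_sum]
      exact Finset.sum_congr rfl fun g _ => hp g x
  smul_mem := by
    rintro g h _ a ⟨x, hx, rfl⟩ ha
    exact ⟨op a • x, N.smul_mem hx ha, rfl⟩

/-- The projection to the cokernel. -/
noncomputable def cokerπ (f : M ⟶ N) : N ⟶ coker f :=
  homMk (LinearMap.range (lin f)).mkQ fun _ m h => ⟨m, h, rfl⟩

theorem comp_cokerπ (f : M ⟶ N) : f ≫ cokerπ f = 0 :=
  hom_ext fun x => (Submodule.Quotient.mk_eq_zero _).2 ⟨x, rfl⟩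

/-- The cokernel is a cokernel in the categorical sense. -/
noncomputable def cokerIsColimit (f : M ⟶ N) :
    IsColimit (CokernelCofork.ofπ (cokerπ f) (comp_cokerπ f)) :=
  CokernelCofork.IsColimit.ofπ _ _
    (fun s hs => homMk ((LinearMap.range (lin f)).liftQ (lin s) (by
        rintro _ ⟨c, rfl⟩
        exact LinearMap.mem_ker.2 (by simpa using congrArg (fun t => lin t c) hs))) (by
      rintro g _ ⟨x, hx, rfl⟩
      exact lin_mem s hx))
    (fun _ _ => rfl)
    (fun s hs m hm => hom_ext fun x => by
      induction x using Submodule.Quotient.induction_on with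
      | _ x => exact congrArg (fun t => lin t x) hm)

instance : HasKernels (GrMod 𝒜) := ⟨fun f => HasLimit.mk ⟨_, kerIsLimit f⟩⟩
instance : HasCokernels (GrMod 𝒜) := ⟨fun f => HasColimit.mk ⟨_, cokerIsColimit f⟩⟩

/-- The zero graded module. -/
@[reducible] def zero (𝒜 : G → Submodule k A) : GrMod 𝒜 where
  carrier := PUnit
  component _ := ⊤
  isInternal := isInternal_of_projections _ (fun _ => 0) (fun _ _ => trivial)
    (fun _ _ _ => rfl) (fun _ _ _ _ _ => rfl) (fun _ => ⟨∅, fun _ _ => rfl⟩)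
  smul_mem _ _ := trivial

theorem isZero_zero : IsZero (zero 𝒜) := by
  rw [IsZero.iff_id_eq_zero]
  exact hom_ext fun x => rfl

instance : HasZeroObject (GrMod 𝒜) := ⟨⟨_, isZero_zero⟩⟩

/-- The direct sum of two graded modules. -/
@[reducible] noncomputable def prod (M N : GrMod 𝒜) : GrMod 𝒜 where
  carrier := M × N
  component g := (M.component g).prod (N.component g)
  isInternal := by
    refine isInternal_of_projections _ (fun g => (M.proj g).prodMap (N.proj g))
      (fun g x => ⟨M.proj_mem g x.1, N.proj_mem g x.2⟩)
      (fun g x hx => Prod.ext (M.proj_self hx.1) (N.proj_self hx.2))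
      (fun g h hgh x hx => Prod.ext (M.proj_ne hgh hx.1) (N.proj_ne hgh hx.2)) fun x => ?_
    obtain ⟨s, hs⟩ := M.proj_sum x.1
    obtain ⟨s', hs'⟩ := N.proj_sum x.2
    refine ⟨s ∪ s', fun t ht => Prod.ext ?_ ?_⟩
    · rw [Prod.fst_sum]; exact hs t (Finset.union_subset_left ht)
    · rw [Prod.snd_sum]; exact hs' t (Finset.union_subset_right ht)
  smul_mem hm ha := ⟨M.smul_mem hm.1 ha, N.smul_mem hm.2 ha⟩

instance : HasBinaryBiproducts (GrMod 𝒜) := ⟨fun M N => by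
  refine hasBinaryBiproduct_of_total
    { pt := prod M N
      fst := homMk (LinearMap.fst _ _ _) fun _ _ h => h.1
      snd := homMk (LinearMap.snd _ _ _) fun _ _ h => h.2
      inl := homMk (LinearMap.inl _ _ _) fun _ _ h => ⟨h, Submodule.zero_mem _⟩
      inr := homMk (LinearMap.inr _ _ _) fun _ _ h => ⟨Submodule.zero_mem _, h⟩
      inl_fst := rfl
      inl_snd := rfl
      inr_fst := rfl
      inr_snd := rfl } ?_
  exact hom_ext fun x => Prod.ext (add_zero _) (zero_add _)⟩

instance : HasFiniteProducts (GrMod 𝒜) :=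
  have : HasTerminal (GrMod 𝒜) := HasZeroObject.hasTerminal
  hasFiniteProducts_of_has_binary_and_terminal

theorem injective_of_mono (f : M ⟶ N) [Mono f] : Function.Injective (lin f) := by
  rw [← LinearMap.ker_eq_bot, eq_bot_iff]
  intro x hx
  have h : kerι f = 0 := by rw [← cancel_mono f, kerι_comp, zero_comp]
  exact congrArg (fun t => lin t (⟨x, hx⟩ : LinearMap.ker (lin f))) h

theorem surjective_of_epi (f : M ⟶ N) [Epi f] : Function.Surjective (lin f) := by
  rw [← LinearMap.range_eq_top, eq_top_iff]
  intro x _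
  have h : cokerπ f = 0 := by rw [← cancel_epi f, comp_cokerπ, comp_zero]
  exact (Submodule.Quotient.mk_eq_zero _).1 (congrArg (fun t => lin t x) h)

theorem mem_of_lin_mem (f : M ⟶ N) (hf : Function.Injective (lin f)) {g : G} {x : M}
    (hx : lin f x ∈ N.component g) : x ∈ M.component g := by
  have : M.proj g x = x := hf ((lin_proj f g x).trans (N.proj_self hx))
  exact this ▸ M.proj_mem g x

theorem exists_lift (f : M ⟶ N) (hf : Function.Surjective (lin f)) {g : G} {y : N}
    (hy : y ∈ N.component g) : ∃ x ∈ M.component g, lin f x = y := by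
  obtain ⟨x, rfl⟩ := hf y
  exact ⟨M.proj g x, M.proj_mem g x, (lin_proj f g x).trans (N.proj_self hy)⟩

/-- Every monomorphism is the kernel of its cokernel. -/
@[reducible] noncomputable def normalMono (f : M ⟶ N) [Mono f] : NormalMono f where
  Z := coker f
  g := cokerπ f
  w := comp_cokerπ f
  isLimit :=
    have hf := injective_of_mono f
    have hmem : ∀ {W : GrMod 𝒜} (s : W ⟶ N) (_ : s ≫ cokerπ f = 0) (c : W),
        lin s c ∈ LinearMap.range (lin f) := fun s hs c =>
      (Submodule.Quotient.mk_eq_zero _).1 (congrArg (fun t => lin t c) hs)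
    have key : ∀ {W : GrMod 𝒜} (s : W ⟶ N) (hs : s ≫ cokerπ f = 0) (c : W),
        lin f (((LinearEquiv.ofInjective (lin f) hf).symm.toLinearMap ∘ₗ
          (lin s).codRestrict _ (hmem s hs)) c) = lin s c := fun s hs c =>
      LinearEquiv.ofInjective_symm_apply (lin f) (h := hf) ⟨lin s c, hmem s hs c⟩
    KernelFork.IsLimit.ofι _ _
      (fun s hs => homMk ((LinearEquiv.ofInjective (lin f) hf).symm.toLinearMap ∘ₗ
          (lin s).codRestrict _ (hmem s hs))
        fun g m hm => mem_of_lin_mem f hf (by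
          rw [key s hs m]
          exact lin_mem s hm))
      (fun s hs => hom_ext fun c => key s hs c)
      (fun s hs m hm => by
        rw [← cancel_mono f, hm]
        exact (hom_ext fun c => key s hs c).symm)

/-- Every epimorphism is the cokernel of its kernel. -/
@[reducible] noncomputable def normalEpi (f : M ⟶ N) [Epi f] : NormalEpi f where
  W := ker f
  g := kerι f
  w := kerι_comp f
  isColimit :=
    have key : ∀ {Z : GrMod 𝒜} (s : M ⟶ Z) (hs : kerι f ≫ s = 0),
        LinearMap.ker (lin f) ≤ LinearMap.ker (lin s) := fun s hs x hx =>
      LinearMap.mem_ker.2 (congrArg (fun t => lin t (⟨x, hx⟩ : LinearMap.ker (lin f))) hs)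
    have key' : ∀ {Z : GrMod 𝒜} (s : M ⟶ Z) (hs : kerι f ≫ s = 0) (x : M),
        (((LinearMap.ker (lin f)).liftQ (lin s) (key s hs)) ∘ₗ
          ((lin f).quotKerEquivOfSurjective (surjective_of_epi f)).symm.toLinearMap) (lin f x) =
        lin s x := fun s hs x => by
      have : ((lin f).quotKerEquivOfSurjective (surjective_of_epi f)).symm (lin f x) =
          Submodule.Quotient.mk x := by
        rw [LinearEquiv.symm_apply_eq]; rfl
      simp [this]
    CokernelCofork.IsColimit.ofπ _ _
      (fun {Z} s hs => homMk (((LinearMap.ker (lin f)).liftQ (lin s) (key s hs)) ∘ₗ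
          ((lin f).quotKerEquivOfSurjective (surjective_of_epi f)).symm.toLinearMap)
        fun g y hy => by
          obtain ⟨x, hx, rfl⟩ := exists_lift f (surjective_of_epi f) hy
          rw [key' s hs x]
          exact lin_mem s hx)
      (fun s hs => hom_ext fun x => key' s hs x)
      (fun s hs m hm => by
        rw [← cancel_epi f, hm]
        refine hom_ext fun x => ?_
        exact (key' s hs x).symm)

noncomputable instance : Abelian (GrMod 𝒜) where
  normalMonoOfMono f _ := ⟨normalMono f⟩
  normalEpiOfEpi f _ := ⟨normalEpi f⟩

end GrMod

/-! ### The quotient category `QGrMod A` of graded modules modulo torsion modules -/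

section QGrMod

variable {k : Type u} {A : Type v} {G : Type w} [Field k] [Ring A] [Algebra k A]
    [AddGroup G] [DecidableEq G] (𝒜 : G → Submodule k A)

/-- `GrTor A`: the graded right `A`-modules `M` such that `mA` is finite dimensional over `k` for
each homogeneous `m ∈ M`. -/
def grTor : ObjectProperty (GrMod 𝒜) :=
  fun M => ∀ g, ∀ m ∈ M.component g, FiniteDimensional k (Submodule.span Aᵐᵒᵖ {m})

theorem grTor_iff (M : GrMod 𝒜) : grTor 𝒜 M ↔ IsTorsionOver k Aᵐᵒᵖ M := by
  refine ⟨fun h m => ?_, fun h g m _ => h m⟩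
  obtain ⟨s, hs⟩ := M.proj_sum m
  have h1 : FiniteDimensional k
      (s.sup fun g => (Submodule.span Aᵐᵒᵖ {M.proj g m}).restrictScalars k : Submodule k M) :=
    by
    have : ∀ g, FiniteDimensional k ((Submodule.span Aᵐᵒᵖ {M.proj g m}).restrictScalars k) :=
      fun g => h g _ (M.proj_mem g m)
    exact Submodule.finite_finset_sup _ _
  have h2 : (Submodule.span Aᵐᵒᵖ {m}).restrictScalars k ≤
      s.sup fun g => (Submodule.span Aᵐᵒᵖ {M.proj g m}).restrictScalars k := by
    intro x hx
    obtain ⟨a, rfl⟩ := Submodule.mem_span_singleton.1 (Submodule.restrictScalars_mem k _ _ |>.1 hx)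
    change a • m ∈ _
    have e : a • m = ∑ g ∈ s, a • M.proj g m := by rw [← Finset.smul_sum, hs s subset_rfl]
    rw [e]
    refine Submodule.sum_mem _ fun g hg => ?_
    exact (Finset.le_sup (f := fun g => (Submodule.span Aᵐᵒᵖ {M.proj g m}).restrictScalars k) hg)
      (Submodule.smul_mem (Submodule.span Aᵐᵒᵖ {M.proj g m}) a
        (Submodule.mem_span_singleton_self _))
  exact Submodule.finiteDimensional_of_le h2

instance grTor_isSerreClass [IsNoetherianRing Aᵐᵒᵖ] : (grTor 𝒜).IsSerreClass where
  exists_zero := ⟨GrMod.zero 𝒜, GrMod.isZero_zero, (grTor_iff 𝒜 _).2 (.of_subsingleton _)⟩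
  prop_of_mono f _ h := (grTor_iff 𝒜 _).2
    (((grTor_iff 𝒜 _).1 h).of_injective (GrMod.lin f) (GrMod.injective_of_mono f))
  prop_of_epi f _ h := (grTor_iff 𝒜 _).2
    (((grTor_iff 𝒜 _).1 h).of_surjective (GrMod.lin f) (GrMod.surjective_of_epi f))
  prop_X₂_of_shortExact {S} hS h₁ h₃ := (grTor_iff 𝒜 _).2
    (.of_exact (GrMod.lin S.f) (GrMod.lin S.g) (fun n hn => by
      have := hS.mono_f
      let l := hS.exact.lift (GrMod.kerι S.g) (GrMod.kerι_comp S.g)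
      have hl : l ≫ S.f = GrMod.kerι S.g := hS.exact.lift_f _ _
      exact ⟨GrMod.lin l (⟨n, hn⟩ : LinearMap.ker (GrMod.lin S.g)),
        congrArg (fun t => GrMod.lin t (⟨n, hn⟩ : LinearMap.ker (GrMod.lin S.g))) hl⟩)
      ((grTor_iff 𝒜 _).1 h₁) ((grTor_iff 𝒜 _).1 h₃))

/-- `QGrMod A = GrMod A / GrTor A`. -/
abbrev QGrMod [IsNoetherianRing Aᵐᵒᵖ] := (grTor 𝒜).isoModSerre.Localization

end QGrMod

/-! ### The functor `(-)_e` -/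

section DegreeZero

variable {k : Type u} {A : Type v} {G : Type w} [Field k] [Ring A] [Algebra k A]
    [AddGroup G] [DecidableEq G] (𝒜 : G → Submodule k A) [GradedAlgebra 𝒜]

/-- The inclusion `A_e → A`, on opposite rings. -/
def degreeZeroIncl : (𝒜 0)ᵐᵒᵖ →+* Aᵐᵒᵖ where
  toFun a := op (a.unop : A)
  map_one' := rfl
  map_mul' _ _ := rfl
  map_zero' := rfl
  map_add' _ _ := rfl

theorem comap_map_degreeZeroIncl (I : Ideal (𝒜 0)ᵐᵒᵖ) :
    (I.map (degreeZeroIncl 𝒜)).comap (degreeZeroIncl 𝒜) = I := by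
  refine le_antisymm (fun x hx => ?_) Ideal.le_comap_map
  have key : ∀ y ∈ I.map (degreeZeroIncl 𝒜), ∀ a : A,
      op (DirectSum.decompose 𝒜 (y.unop * a) 0) ∈ I := by
    intro y hy
    refine Submodule.span_induction ?_ ?_ ?_ ?_ hy
    · rintro _ ⟨i, hi, rfl⟩ a
      have : op (DirectSum.decompose 𝒜 ((degreeZeroIncl 𝒜 i).unop * a) 0) =
          op (DirectSum.decompose 𝒜 a 0) * i := by
        apply MulOpposite.unop_injective
        apply Subtype.ext
        have := DirectSum.coe_decompose_mul_of_left_mem_zero 𝒜 (b := a) (j := 0) i.unop.2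
        exact this
      rw [this]
      exact I.mul_mem_left _ hi
    · intro a
      simp
    · intro y z _ _ hy hz a
      have := I.add_mem (hy a) (hz a)
      rw [← MulOpposite.op_add] at this
      simpa [add_mul, DirectSum.decompose_add] using this
    · intro b y _ hy a
      have := hy (b.unop * a)
      rwa [← mul_assoc] at this
  have := key _ hx 1
  rw [mul_one] at this
  have h : DirectSum.decompose 𝒜 (degreeZeroIncl 𝒜 x).unop 0 = x.unop :=
    Subtype.ext (DirectSum.decompose_of_mem_same 𝒜 x.unop.2)
  rwa [h] at this

/-- If `A` is right noetherian then so is `A_e`. -/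
instance isNoetherianRing_degreeZero [IsNoetherianRing Aᵐᵒᵖ] : IsNoetherianRing (𝒜 0)ᵐᵒᵖ := by
  rw [isNoetherianRing_iff, isNoetherian_iff']
  have h : WellFoundedGT (Ideal Aᵐᵒᵖ) := by
    exact isNoetherian_iff'.1 (isNoetherianRing_iff.1 inferInstance)
  have hm : StrictMono (Ideal.map (degreeZeroIncl 𝒜)) :=
    Monotone.strictMono_of_injective (fun _ _ h => Ideal.map_mono h) fun I J h => by
      rw [← comap_map_degreeZeroIncl 𝒜 I, ← comap_map_degreeZeroIncl 𝒜 J]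
      exact congrArg _ h
  exact hm.wellFoundedGT

variable {𝒜}

/-- The component `M_e` as a right `A_e`-module. -/
instance GrMod.moduleDegreeZero (M : GrMod 𝒜) : Module (𝒜 0)ᵐᵒᵖ (M.component 0) where
  smul a m := ⟨op (a.unop : A) • (m : M), by
    have := M.smul_mem m.2 a.unop.2
    rwa [add_zero] at this⟩
  one_smul m := Subtype.ext (one_smul Aᵐᵒᵖ (m : M))
  mul_smul a b m := Subtype.ext (mul_smul (op (a.unop : A)) (op (b.unop : A)) (m : M))
  smul_zero a := Subtype.ext (smul_zero (op (a.unop : A)))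
  smul_add a m n := Subtype.ext (smul_add (op (a.unop : A)) (m : M) (n : M))
  add_smul a b m := Subtype.ext (add_smul (op (a.unop : A)) (op (b.unop : A)) (m : M))
  zero_smul m := Subtype.ext (zero_smul Aᵐᵒᵖ (m : M))

theorem GrMod.coe_degreeZero_smul (M : GrMod 𝒜) (a : (𝒜 0)ᵐᵒᵖ) (m : M.component 0) :
    ((a • m : M.component 0) : M) = op (a.unop : A) • (m : M) := rfl

variable (𝒜)

/-- The functor `(-)_e : GrMod A ⥤ Mod A_e`. -/
def degreeZero : GrMod 𝒜 ⥤ ModuleCat.{v} (𝒜 0)ᵐᵒᵖ where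
  obj M := ModuleCat.of (𝒜 0)ᵐᵒᵖ (M.component 0)
  map {M N} f := ModuleCat.ofHom
    { toFun := fun m => ⟨GrMod.lin f (m : M), GrMod.lin_mem f m.2⟩
      map_add' := fun m n => Subtype.ext (map_add (GrMod.lin f) (m : M) (n : M))
      map_smul' := fun a m => Subtype.ext (map_smul (GrMod.lin f) (op (a.unop : A)) (m : M)) }

open scoped ModuleCat in
/-- A right `A_e`-module which embeds into a torsion `A`-module is torsion. -/
theorem torModule_of_embedding {M : GrMod 𝒜} (hM : grTor 𝒜 M) (N : ModuleCat.{v} (𝒜 0)ᵐᵒᵖ)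
    (i : N →+ M) (hi : Function.Injective i)
    (h : ∀ (a : (𝒜 0)ᵐᵒᵖ) (n : N), i (a • n) = op (a.unop : A) • i n) :
    torModule k (𝒜 0) N := by
  intro n
  have := (grTor_iff 𝒜 M).1 hM (i n)
  let j : Submodule.span (𝒜 0)ᵐᵒᵖ {n} →ₗ[k] Submodule.span Aᵐᵒᵖ {i n} :=
    { toFun := fun x => ⟨i x, by
        obtain ⟨a, ha⟩ := Submodule.mem_span_singleton.1 x.2
        rw [← ha, h]
        exact Submodule.smul_mem _ _ (Submodule.mem_span_singleton_self _)⟩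
      map_add' := fun x y => Subtype.ext (map_add i x.1 y.1)
      map_smul' := fun c x => Subtype.ext (by
        change i (c • x.1) = c • i x.1
        rw [← algebraMap_smul (𝒜 0)ᵐᵒᵖ c x.1, h, ← algebraMap_smul Aᵐᵒᵖ c (i x.1)]
        rfl) }
  exact FiniteDimensional.of_injective j fun x y hxy =>
    Subtype.ext (hi (congrArg Subtype.val hxy))

/-- The functor `(-)_e` sends isomorphisms modulo `GrTor A` to isomorphisms modulo `Tor A_e`. -/
theorem degreeZero_isoModSerre [IsNoetherianRing Aᵐᵒᵖ] {M N : GrMod 𝒜} (f : M ⟶ N)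
    (hf : (grTor 𝒜).isoModSerre f) :
    (torModule k (𝒜 0)).isoModSerre ((degreeZero 𝒜).map f) := by
  have hker : grTor 𝒜 (GrMod.ker f) := (grTor 𝒜).prop_of_iso
    (IsLimit.conePointUniqueUpToIso (limit.isLimit _) (GrMod.kerIsLimit f)) hf.1
  have hcoker : grTor 𝒜 (GrMod.coker f) := (grTor 𝒜).prop_of_iso
    (IsColimit.coconePointUniqueUpToIso (colimit.isColimit _) (GrMod.cokerIsColimit f)) hf.2
  constructor
  · refine (torModule k (𝒜 0)).prop_of_iso (ModuleCat.kernelIsoKer _).symm ?_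
    exact torModule_of_embedding 𝒜 hker _
      { toFun := fun x => ⟨(x.1 : M.component 0).1,
          congrArg (Subtype.val : N.component 0 → N) x.2⟩
        map_zero' := rfl
        map_add' := fun _ _ => rfl }
      (fun x y hxy => Subtype.ext (Subtype.ext (congrArg (fun z => (z.1 : M)) hxy)))
      (fun _ _ => rfl)
  · refine (torModule k (𝒜 0)).prop_of_iso (ModuleCat.cokernelIsoRangeQuotient _).symm ?_
    let F := ((degreeZero 𝒜).map f).hom
    let q : N.component 0 →+ (N ⧸ LinearMap.range (GrMod.lin f)) :=
      (LinearMap.range (GrMod.lin f)).mkQ.toAddMonoidHom.comp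
        (N.component 0).subtype.toAddMonoidHom
    have hq : ∀ x : N.component 0, q x = 0 ↔ x ∈ LinearMap.range F := by
      intro x
      refine (Submodule.Quotient.mk_eq_zero _).trans ⟨?_, ?_⟩
      · rintro ⟨y, hy⟩
        refine ⟨⟨M.proj 0 y, M.proj_mem 0 y⟩, Subtype.ext ?_⟩
        exact (GrMod.lin_proj f 0 y).trans ((congrArg _ hy).trans (N.proj_self x.2))
      · rintro ⟨y, hy⟩
        exact ⟨y.1, congrArg (Subtype.val : N.component 0 → N) hy⟩
    let i : (N.component 0 ⧸ LinearMap.range F) →+ (N ⧸ LinearMap.range (GrMod.lin f)) :=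
      QuotientAddGroup.lift (LinearMap.range F).toAddSubgroup q fun x hx => (hq x).2 hx
    refine torModule_of_embedding 𝒜 hcoker _ i ?_ ?_
    · rw [injective_iff_map_eq_zero]
      rintro ⟨x⟩ hx
      exact (Submodule.Quotient.mk_eq_zero _).2 ((hq x).1 hx)
    · rintro a ⟨x⟩
      rfl

/-- The functor `(-)_e : QGrMod A ⥤ QMod A_e` induced by `(-)_e : GrMod A ⥤ Mod A_e` on the
quotient categories. -/
noncomputable def degreeZeroQ [IsNoetherianRing Aᵐᵒᵖ] :
    QGrMod 𝒜 ⥤ QMod.{u, v, v} k (𝒜 0) :=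
  Localization.Construction.lift
    (degreeZero 𝒜 ⋙ (torModule k (𝒜 0)).isoModSerre.Q) fun _ _ f hf =>
      (torModule k (𝒜 0)).isoModSerre.Q_inverts _ (degreeZero_isoModSerre 𝒜 f hf)

end DegreeZero

/-! ### Scalars of degree `e` -/

section DegreeZeroSMul

variable {k : Type u} {A : Type v} {G : Type w} [Field k] [Ring A] [Algebra k A]
    [AddGroup G] [DecidableEq G] {𝒜 : G → Submodule k A}

/-! Everything passes through the condition (T): if `M_e` is torsion over `A_e`, then `M` is
torsion.

Density and finite-dimensional detection. For a noetherian `M`, each `M_g` is a finite sum of pieces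
`m A_e`. Density writes `A_e` as `A_{g⁻¹} A_g` plus a finite dimensional space, so `M_g` lies in
`M_e A_g` plus a finite dimensional space. Since `A` is left noetherian, `A_g = A_e S` with `S`
finite, hence `M_e A_g` lies in `M_e` times the span of `S`, which is finite dimensional when `M_e`
is (`IsDenselyGraded.finiteDimensional`). Conversely, `A / A_g A`, shifted so that `A_g` sits in
degree `e`, is cyclic with zero degree-`e` part. Detection makes it finite dimensional, and it
contains `A_e / A_g A_{g⁻¹}` because `A_g A ∩ A_e = A_g A_{g⁻¹}`
(`finiteDimensional_quotient_of_detect`).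

Detection and (T). A finitely generated torsion module is finite dimensional. Over noetherian rings
this lets one pass between the two conditions by looking at `mA` for `m` homogeneous
(`grTor_of_detect`, `finiteDimensional_of_torModule_le`).

(T) and the equivalence. The functor `(-)_e` has the right adjoint `N ↦ Hom_{A_e}(A, N)`, whose
counit is invertible because `Hom_{A_e}(A_e, N) = N`. Hence `(-)_e` is a localization, and so is its
composite with `Mod A_e → QMod A_e`. Under (T) the composite localizes at exactly the isomorphisms
modulo `GrTor A`, so the induced functor is an equivalence. Conversely an equivalence reflects
isomorphisms, and (T) follows by applying this to `M → 0`. -/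

theorem GrMod.proj_smul_degreeZero (M : GrMod 𝒜) (g : G) {b : A} (hb : b ∈ 𝒜 0) (m : M) :
    M.proj g (op b • m) = op b • M.proj g m := by
  obtain ⟨s, hs⟩ := M.proj_sum m
  have ht := hs (insert g s) (Finset.subset_insert _ _)
  conv_lhs => rw [← ht, Finset.smul_sum, map_sum]
  have key : ∀ h, op b • M.proj h m ∈ M.component h := fun h => by
    simpa using M.smul_mem (M.proj_mem h m) hb
  rw [Finset.sum_eq_single_of_mem g (Finset.mem_insert_self _ _), M.proj_self (key g)]
  exact fun h _ hh => M.proj_ne hh.symm (key h)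

end DegreeZeroSMul

/-! ### Coinduction `N ↦ Hom_{A_e}(A, N)` and its adjunction with `(-)_e` -/

section Coinduced

variable {k : Type u} {A : Type v} {G : Type w} [Field k] [Ring A] [Algebra k A]
    [AddGroup G] [DecidableEq G] (𝒜 : G → Submodule k A) [GradedAlgebra 𝒜]

/-- The right `A_e`-linear maps `A → N`. -/
def coinducedSubgroup (N : ModuleCat.{v} (𝒜 0)ᵐᵒᵖ) : AddSubgroup (A →+ N) where
  carrier := {f | ∀ (a : A) (b : 𝒜 0), f (a * b) = op b • f a}
  add_mem' hf hg a b := by simp [hf a b, hg a b]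
  zero_mem' a b := by simp
  neg_mem' hf a b := by simp [hf a b]

variable {𝒜}

section

variable {N : ModuleCat.{v} (𝒜 0)ᵐᵒᵖ}

instance : CoeFun (coinducedSubgroup 𝒜 N) (fun _ => A → N) := ⟨fun f => f.1⟩

namespace coinducedSubgroup

@[ext] theorem ext {f g : coinducedSubgroup 𝒜 N} (h : ∀ a, f a = g a) : f = g :=
  Subtype.ext (AddMonoidHom.ext h)

theorem map_mul (f : coinducedSubgroup 𝒜 N) (a : A) (b : 𝒜 0) : f (a * b) = op b • f a :=
  f.2 a b

@[simp] theorem map_add (f : coinducedSubgroup 𝒜 N) (a b : A) : f (a + b) = f a + f b :=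
  f.1.map_add a b
@[simp] theorem map_zero (f : coinducedSubgroup 𝒜 N) : f 0 = 0 := f.1.map_zero

/-- Evaluation at an element of `A`. -/
def eval (a : A) : coinducedSubgroup 𝒜 N →+ N :=
  (AddMonoidHom.eval a).comp (coinducedSubgroup 𝒜 N).subtype

@[simp] theorem eval_apply (a : A) (f : coinducedSubgroup 𝒜 N) : eval a f = f a := rfl

instance : Module Aᵐᵒᵖ (coinducedSubgroup 𝒜 N) where
  smul a f := ⟨f.1.comp (AddMonoidHom.mulLeft a.unop), fun x b => by
    have := map_mul f (a.unop * x) b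
    rwa [mul_assoc] at this⟩
  one_smul f := ext fun x => congrArg f (one_mul x)
  mul_smul a b f := ext fun x => congrArg f (mul_assoc b.unop a.unop x)
  smul_zero a := rfl
  smul_add a f g := rfl
  add_smul a b f := ext fun x => by
    change f ((a + b).unop * x) = f (a.unop * x) + f (b.unop * x)
    rw [← map_add, MulOpposite.unop_add, add_mul]
  zero_smul f := ext fun x => by
    change f ((0 : Aᵐᵒᵖ).unop * x) = 0
    rw [MulOpposite.unop_zero, zero_mul, map_zero]

theorem smul_apply (a : Aᵐᵒᵖ) (f : coinducedSubgroup 𝒜 N) (x : A) :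
    (a • f) x = f (a.unop * x) := rfl

/-- Scalars act through `A`, hence on the argument of a map; this makes the tower condition
definitional. -/
instance : Module k (coinducedSubgroup 𝒜 N) :=
  Module.compHom _ (algebraMap k Aᵐᵒᵖ)

instance : IsScalarTower k Aᵐᵒᵖ (coinducedSubgroup 𝒜 N) :=
  .of_algebraMap_smul fun _ _ => rfl

theorem base_smul_apply (c : k) (f : coinducedSubgroup 𝒜 N) (x : A) :
    (c • f) x = f (c • x) := by
  change f (algebraMap k A c * x) = _
  rw [Algebra.smul_def]

variable (𝒜 N) in
/-- The maps of degree `g` are those vanishing away from degree `-g`. -/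
def component (g : G) : Submodule k (coinducedSubgroup 𝒜 N) where
  carrier := {f | ∀ h, h ≠ -g → ∀ a ∈ 𝒜 h, f a = 0}
  add_mem' hf hg h hh a ha := by simp [hf h hh a ha, hg h hh a ha]
  zero_mem' h hh a ha := rfl
  smul_mem' c f hf h hh a ha := by
    rw [base_smul_apply]
    exact hf h hh _ ((𝒜 h).smul_mem c ha)

theorem proj_mul_degreeZero (g : G) (a : A) (b : 𝒜 0) :
    GradedRing.proj 𝒜 g (a * b) = GradedRing.proj 𝒜 g a * b := by
  simp only [GradedRing.proj_apply]
  exact DirectSum.coe_decompose_mul_of_right_mem_zero 𝒜 b.2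

variable (𝒜 N) in
/-- The projection to the maps of degree `g`. -/
def proj (g : G) : coinducedSubgroup 𝒜 N →ₗ[k] coinducedSubgroup 𝒜 N where
  toFun f := ⟨f.1.comp (GradedRing.proj 𝒜 (-g)), fun a b => by
    have := map_mul f (GradedRing.proj 𝒜 (-g) a) b
    rwa [← proj_mul_degreeZero] at this⟩
  map_add' _ _ := rfl
  map_smul' c f := ext fun x => by
    simp only [RingHom.id_apply, base_smul_apply]
    change (c • f) (GradedRing.proj 𝒜 (-g) x) = f (GradedRing.proj 𝒜 (-g) (c • x))
    rw [base_smul_apply, GradedRing.proj_apply, GradedRing.proj_apply, DirectSum.decompose_smul]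
    rfl

theorem proj_apply (g : G) (f : coinducedSubgroup 𝒜 N) (x : A) :
    proj 𝒜 N g f x = f (DirectSum.decompose 𝒜 x (-g)) := rfl

/-- Expand `x` into homogeneous parts: `f` kills all of them except the one of degree `-g`. -/
theorem apply_eq_of_mem {g : G} {f : coinducedSubgroup 𝒜 N} (hf : f ∈ component 𝒜 N g) (x : A) :
    f (DirectSum.decompose 𝒜 x (-g)) = f x := by
  classical
  have := congrArg f.1 (DirectSum.sum_support_decompose 𝒜 x)
  rw [map_sum] at this
  rw [← show _ = f x from this]
  by_cases h : -g ∈ (DirectSum.decompose 𝒜 x).support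
  · rw [Finset.sum_eq_single_of_mem _ h]
    exact fun b _ hb => hf b hb _ (DirectSum.decompose 𝒜 x b).2
  · rw [DFinsupp.notMem_support_iff.1 h, Finset.sum_eq_zero]
    · exact map_zero f
    · intro b hb
      exact hf b (fun e => h (e ▸ hb)) _ (DirectSum.decompose 𝒜 x b).2

/-- Finiteness of `G` is essential: it makes a map the finite sum of its restrictions to the
components of `A`. -/
theorem isInternal [Finite G] : DirectSum.IsInternal (component 𝒜 N) := by
  classical
  have := Fintype.ofFinite G
  refine isInternal_of_projections _ (proj 𝒜 N) ?_ ?_ ?_ ?_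
  · intro g f h hh a ha
    rw [proj_apply, DirectSum.decompose_of_mem_ne 𝒜 ha hh, map_zero]
  · exact fun g f hf => ext fun x => apply_eq_of_mem hf x
  · intro g h hgh f hf
    exact ext fun x => hf (-g) (fun e => hgh (neg_injective e)) _
      (DirectSum.decompose 𝒜 x (-g)).2
  · intro f
    refine ⟨Finset.univ, fun t ht => ?_⟩
    obtain rfl : t = Finset.univ := Finset.eq_univ_iff_forall.2 fun g => ht (Finset.mem_univ g)
    refine ext fun x => ?_
    rw [← eval_apply, map_sum]
    simp only [eval_apply, proj_apply]
    -- The part of degree `g` lives on degree `-g` of `A`, so the sum is reindexed by negation.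
    refine (Equiv.sum_comp (Equiv.neg G) fun g => f.1 (DirectSum.decompose 𝒜 x g)).trans ?_
    rw [← map_sum]
    refine congrArg f.1 ?_
    conv_rhs => rw [← DirectSum.sum_support_decompose 𝒜 x]
    refine (Finset.sum_subset (Finset.subset_univ _) fun g _ hg => ?_).symm
    rw [DFinsupp.notMem_support_iff.1 hg, ZeroMemClass.coe_zero]

theorem smul_mem {g h : G} {f : coinducedSubgroup 𝒜 N} {a : A}
    (hf : f ∈ component 𝒜 N g) (ha : a ∈ 𝒜 h) : op a • f ∈ component 𝒜 N (g + h) := by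
  intro j hj x hx
  rw [smul_apply]
  -- `f` sees `a x` only if `h + j = -g`, that is `j = -h + -g = -(g + h)`; the order matters, as
  -- `G` need not be commutative.
  refine hf (h + j) (fun e => hj ?_) _ (SetLike.mul_mem_graded ha hx)
  rw [neg_add_rev, ← e, neg_add_cancel_left]

end coinducedSubgroup

end

variable [Finite G]

section

variable {N : ModuleCat.{v} (𝒜 0)ᵐᵒᵖ}

variable (𝒜 N) in
/-- The graded module coinduced from an `A_e`-module. -/
@[reducible] def coinduced : GrMod 𝒜 where
  carrier := coinducedSubgroup 𝒜 N
  component := coinducedSubgroup.component 𝒜 N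
  isInternal := coinducedSubgroup.isInternal
  smul_mem := coinducedSubgroup.smul_mem

/-- As `1` has degree `e`, all homogeneous parts of `f` of nonzero degree vanish on it. -/
theorem coinduced_proj_zero_apply_one (f : coinducedSubgroup 𝒜 N) :
    ((coinduced 𝒜 N).proj 0 f : coinducedSubgroup 𝒜 N) 1 = f 1 := by
  obtain ⟨s, hs⟩ := (coinduced 𝒜 N).proj_sum f
  have ht := congrArg (coinducedSubgroup.eval 1) (hs (insert 0 s) (Finset.subset_insert _ _))
  rw [map_sum, Finset.sum_eq_single_of_mem 0 (Finset.mem_insert_self _ _)] at ht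
  · exact ht
  · intro g _ hg
    exact (coinduced 𝒜 N).proj_mem g f 0 (fun e => hg (neg_eq_zero.1 e.symm)) 1
      SetLike.GradedOne.one_mem

/-- The map `M → Hom(A, N)` corresponding to `M_e → N`. -/
noncomputable def toCoinduced (M : GrMod 𝒜) (φ : (degreeZero 𝒜).obj M ⟶ N) :
    M ⟶ coinduced 𝒜 N :=
  GrMod.homMk
    { toFun := fun m => ⟨
        { toFun := fun a => φ.hom ⟨M.proj 0 (op a • m), M.proj_mem 0 _⟩
          map_zero' := by
            refine Eq.trans (congrArg φ.hom (Subtype.ext ?_)) (_root_.map_zero φ.hom)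
            exact (congrArg (M.proj 0) (zero_smul _ m)).trans (_root_.map_zero _)
          map_add' := fun a b => by
            refine Eq.trans (congrArg φ.hom (Subtype.ext ?_)) (_root_.map_add φ.hom _ _)
            exact (congrArg (M.proj 0) (add_smul (op a) (op b) m)).trans (_root_.map_add _ _ _) },
        fun a b => by
          refine Eq.trans ?_ (_root_.map_smul φ.hom (op b) _)
          refine congrArg φ.hom (Subtype.ext ?_)
          rw [op_mul, mul_smul]
          exact M.proj_smul_degreeZero 0 b.2 _⟩
      map_add' := fun m n => coinducedSubgroup.ext fun a => by
        refine Eq.trans ?_ (_root_.map_add φ.hom _ _)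
        refine congrArg φ.hom (Subtype.ext ?_)
        exact (congrArg (M.proj 0) (smul_add (op a) m n)).trans (_root_.map_add _ _ _)
      map_smul' := fun b m => coinducedSubgroup.ext fun a => by
        refine congrArg φ.hom (Subtype.ext ?_)
        change M.proj 0 (op a • b • m) = M.proj 0 (op (b.unop * a) • m)
        rw [op_mul, mul_smul, op_unop] }
    (fun g m hm h hh a ha => by
      refine Eq.trans (congrArg φ.hom (Subtype.ext ?_)) (_root_.map_zero φ.hom)
      refine M.proj_ne (fun e => hh ?_) (M.smul_mem hm ha)
      exact (neg_eq_of_add_eq_zero_right e.symm).symm)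

theorem toCoinduced_apply (M : GrMod 𝒜) (φ : (degreeZero 𝒜).obj M ⟶ N) (m : M) (a : A) :
    (GrMod.lin (toCoinduced M φ) m : coinducedSubgroup 𝒜 N) a =
      φ.hom ⟨M.proj 0 (op a • m), M.proj_mem 0 _⟩ := rfl

/-- The map `M_e → N` corresponding to `M → Hom(A, N)`. -/
def ofCoinduced (M : GrMod 𝒜) (ψ : M ⟶ coinduced 𝒜 N) : (degreeZero 𝒜).obj M ⟶ N :=
  ModuleCat.ofHom (X := M.component 0)
    { toFun := fun m => (GrMod.lin ψ (m : M) : coinducedSubgroup 𝒜 N) 1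
      map_add' := fun m n => by simp
      map_smul' := fun b m => by
        -- Both `b` acting on `ψ m` and `b` acting on the value `(ψ m) 1` amount to evaluating `ψ m`
        -- at `b = b * 1 = 1 * b`.
        rw [GrMod.coe_degreeZero_smul, _root_.map_smul, coinducedSubgroup.smul_apply, RingHom.id_apply,
          unop_op, mul_one, ← one_mul (b.unop : A), coinducedSubgroup.map_mul, op_unop] }

theorem ofCoinduced_apply (M : GrMod 𝒜) (ψ : M ⟶ coinduced 𝒜 N) (m : M.component 0) :
    (ofCoinduced M ψ).hom m = (GrMod.lin ψ (m : M) : coinducedSubgroup 𝒜 N) 1 := rfl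

variable (N) in
/-- The adjunction bijection for coinduction. -/
noncomputable def coinducedEquiv (M : GrMod 𝒜) :
    ((degreeZero 𝒜).obj M ⟶ N) ≃ (M ⟶ coinduced 𝒜 N) where
  toFun := toCoinduced M
  invFun := ofCoinduced M
  left_inv φ := by
    ext m
    change φ.hom _ = φ.hom m
    refine congrArg φ.hom (Subtype.ext ?_)
    obtain ⟨m, hm⟩ := m
    change M.proj 0 (op (1 : A) • m) = m
    rw [op_one, one_smul]
    exact M.proj_self hm
  -- `ψ` is recovered from its values at `1`, because `(ψ m) a = (ψ (m a)) 1`.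
  right_inv ψ := GrMod.hom_ext fun m => coinducedSubgroup.ext fun a => by
    rw [toCoinduced_apply, ofCoinduced_apply, GrMod.lin_proj, coinduced_proj_zero_apply_one,
      _root_.map_smul, coinducedSubgroup.smul_apply, unop_op, mul_one]

end

variable (𝒜) in
/-- Coinduction `Mod A_e ⥤ GrMod A`. -/
noncomputable def coinducedFunctor : ModuleCat.{v} (𝒜 0)ᵐᵒᵖ ⥤ GrMod 𝒜 :=
  Adjunction.rightAdjointOfEquiv (F := degreeZero 𝒜) (fun M N => coinducedEquiv N M)
    fun _ M N f g => GrMod.hom_ext fun m => coinducedSubgroup.ext fun a => by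
      refine congrArg g.hom (Subtype.ext ?_)
      change GrMod.lin f _ = M.proj 0 (op a • GrMod.lin f m)
      rw [GrMod.lin_proj, _root_.map_smul]

variable (𝒜) in
/-- The functor `(-)_e` is left adjoint to coinduction. -/
noncomputable def coinducedAdjunction : degreeZero 𝒜 ⊣ coinducedFunctor 𝒜 :=
  Adjunction.adjunctionOfEquivRight _ _

theorem coinducedAdjunction_counit_app (N : ModuleCat.{v} (𝒜 0)ᵐᵒᵖ) :
    (coinducedAdjunction 𝒜).counit.app N = ofCoinduced (coinduced 𝒜 N) (𝟙 _) := by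
  simp [coinducedAdjunction]
  rfl

/-- A map of degree `e` factors through `A → A_e`, and on `A_e` it is `b ↦ f(1) b`. The preimage of
`n` is therefore `a ↦ n a_e`. -/
theorem bijective_ofCoinduced_id (N : ModuleCat.{v} (𝒜 0)ᵐᵒᵖ) :
    Function.Bijective (ofCoinduced (coinduced 𝒜 N) (𝟙 _)).hom := by
  constructor
  · rw [injective_iff_map_eq_zero]
    intro f hf
    refine Subtype.ext (coinducedSubgroup.ext fun a => ?_)
    rw [← coinducedSubgroup.apply_eq_of_mem f.2, ← one_mul (DirectSum.decompose 𝒜 a (-0) : A)]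
    have e : (-0 : G) = 0 := neg_zero
    rw [e, coinducedSubgroup.map_mul]
    exact (congrArg _ hf).trans (smul_zero _)
  · intro n
    let f : coinducedSubgroup 𝒜 N :=
      ⟨{ toFun := fun a => op (DirectSum.decompose 𝒜 a 0) • n
         map_zero' := by simp
         map_add' := fun a b => by simp [DirectSum.decompose_add, add_smul] }, fun a b => by
        change op (DirectSum.decompose 𝒜 (a * b) 0) • n = op b • op (DirectSum.decompose 𝒜 a 0) • n
        rw [← mul_smul, ← op_mul]
        congr 2
        exact Subtype.ext (DirectSum.coe_decompose_mul_of_right_mem_zero 𝒜 b.2)⟩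
    refine ⟨⟨f, fun h hh a ha => ?_⟩, ?_⟩
    · change op (DirectSum.decompose 𝒜 a 0) • n = 0
      rw [neg_zero] at hh
      rw [show DirectSum.decompose 𝒜 a 0 = 0 from
        Subtype.ext (DirectSum.decompose_of_mem_ne 𝒜 ha hh), MulOpposite.op_zero, zero_smul]
    · change op (DirectSum.decompose 𝒜 1 0) • n = n
      rw [show DirectSum.decompose 𝒜 1 0 = 1 from
        Subtype.ext (DirectSum.decompose_of_mem_same 𝒜 SetLike.GradedOne.one_mem), op_one, one_smul]

instance isIso_coinducedAdjunction_counit : IsIso (coinducedAdjunction 𝒜).counit := by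
  have (N : ModuleCat.{v} (𝒜 0)ᵐᵒᵖ) : IsIso ((coinducedAdjunction 𝒜).counit.app N) := by
    rw [coinducedAdjunction_counit_app]
    exact (ConcreteCategory.isIso_iff_bijective (ofCoinduced (coinduced 𝒜 N) (𝟙 _))).2
      (bijective_ofCoinduced_id N)
  exact NatIso.isIso_of_isIso_app _

end Coinduced

/-! ### The condition (T) and the equivalence of quotient categories -/

section Equivalence

variable {k : Type u} {A : Type v} {G : Type w} [Field k] [Ring A] [Algebra k A]
    [AddGroup G] [DecidableEq G] (𝒜 : G → Submodule k A) [GradedAlgebra 𝒜]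

instance : (degreeZero 𝒜).Additive where

theorem mono_degreeZero_map {M N : GrMod 𝒜} (f : M ⟶ N) [Mono f] :
    Mono ((degreeZero 𝒜).map f) :=
  (ModuleCat.mono_iff_injective _).2 fun _ _ h =>
    Subtype.ext (GrMod.injective_of_mono f (congrArg (Subtype.val : N.component 0 → N) h))

theorem epi_degreeZero_map {M N : GrMod 𝒜} (f : M ⟶ N) [Epi f] :
    Epi ((degreeZero 𝒜).map f) :=
  (ModuleCat.epi_iff_surjective _).2 fun y => by
    obtain ⟨x, hx, e⟩ := GrMod.exists_lift f (GrMod.surjective_of_epi f) y.2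
    exact ⟨⟨x, hx⟩, Subtype.ext e⟩

variable [IsNoetherianRing Aᵐᵒᵖ]

/-- If `M_e` torsion implies `M` torsion, then `(-)_e` reflects isomorphisms modulo torsion. -/
theorem isoModSerre_of_degreeZero
    (H : ∀ M : GrMod 𝒜, torModule k (𝒜 0) ((degreeZero 𝒜).obj M) → grTor 𝒜 M)
    {M N : GrMod 𝒜} (f : M ⟶ N)
    (hf : (torModule k (𝒜 0)).isoModSerre ((degreeZero 𝒜).map f)) :
    (grTor 𝒜).isoModSerre f := by
  constructor
  -- Only half of exactness is needed: `(ker f)_e` embeds into `ker (f_e)`, and torsion passes to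
  -- submodules.
  · let i : (degreeZero 𝒜).obj (kernel f) ⟶ kernel ((degreeZero 𝒜).map f) :=
      kernel.lift _ ((degreeZero 𝒜).map (kernel.ι f)) (by
        rw [← Functor.map_comp, kernel.condition, Functor.map_zero])
    have : Mono i := by
      have := mono_degreeZero_map 𝒜 (kernel.ι f)
      exact mono_of_mono_fac (kernel.lift_ι _ _ _)
    exact H _ ((torModule k (𝒜 0)).prop_of_mono i hf.1)
  -- Dually, `coker (f_e)` surjects onto `(coker f)_e`, and torsion passes to quotients.
  · let p : cokernel ((degreeZero 𝒜).map f) ⟶ (degreeZero 𝒜).obj (cokernel f) :=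
      cokernel.desc _ ((degreeZero 𝒜).map (cokernel.π f)) (by
        rw [← Functor.map_comp, cokernel.condition, Functor.map_zero])
    have : Epi p := by
      have := epi_degreeZero_map 𝒜 (cokernel.π f)
      exact epi_of_epi_fac (cokernel.π_desc _ _ _)
    exact H _ ((torModule k (𝒜 0)).prop_of_epi p hf.2)

theorem degreeZeroQ_isEquivalence [Finite G]
    (H : ∀ M : GrMod 𝒜, torModule k (𝒜 0) ((degreeZero 𝒜).obj M) → grTor 𝒜 M) :
    (degreeZeroQ 𝒜).IsEquivalence := by
  let adj := coinducedAdjunction 𝒜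
  have := adj.fullyFaithfulROfIsIsoCounit.full
  have := adj.fullyFaithfulROfIsIsoCounit.faithful
  -- A left adjoint of a fully faithful functor is a localization at the morphisms it inverts.
  have := adj.isLocalization
  have h : (degreeZero 𝒜 ⋙ (torModule k (𝒜 0)).isoModSerre.Q).IsLocalization
      (grTor 𝒜).isoModSerre := by
    refine Functor.IsLocalization.comp (degreeZero 𝒜) (torModule k (𝒜 0)).isoModSerre.Q
      ((MorphismProperty.isomorphisms _).inverseImage (degreeZero 𝒜))
      (torModule k (𝒜 0)).isoModSerre _ ?_ ?_ ?_
    · exact fun _ _ f hf => (torModule k (𝒜 0)).isoModSerre.Q_inverts _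
        (degreeZero_isoModSerre 𝒜 f hf)
    · exact fun _ _ f hf => isoModSerre_of_degreeZero 𝒜 H f
        ((torModule k (𝒜 0)).isomorphisms_le_isoModSerre _ hf)
    -- Through the counit, `g` is the degree-`e` part of its coinduced map, which is an isomorphism
    -- modulo torsion by (T).
    · intro X Y g hg
      have e : Arrow.mk ((degreeZero 𝒜).map ((coinducedFunctor 𝒜).map g)) ≅ Arrow.mk g :=
        Arrow.isoMk (asIso (adj.counit.app X)) (asIso (adj.counit.app Y))
          (adj.counit.naturality g).symm
      exact ⟨_, _, (coinducedFunctor 𝒜).map g, isoModSerre_of_degreeZero 𝒜 H _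
        (((torModule k (𝒜 0)).isoModSerre.arrow_mk_iso_iff e).2 hg), ⟨e⟩⟩
  -- By definition of a localization, the functor induced on the constructed localization, here
  -- `degreeZeroQ 𝒜`, is an equivalence.
  exact h.isEquivalence

/-- If `M_e` is torsion, `M → 0` becomes invertible in `QMod A_e`, hence already in `QGrMod A`,
which forces `M` to be torsion. -/
theorem grTor_of_degreeZeroQ_isEquivalence [(degreeZeroQ 𝒜).IsEquivalence] (M : GrMod 𝒜)
    (hM : torModule k (𝒜 0) ((degreeZero 𝒜).obj M)) : grTor 𝒜 M := by
  let f : M ⟶ GrMod.zero 𝒜 := 0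
  have hz := GrMod.isZero_zero (𝒜 := 𝒜)
  have hz' := (degreeZero 𝒜).map_isZero hz
  have hf : (torModule k (𝒜 0)).isoModSerre ((degreeZero 𝒜).map f) := by
    rw [Functor.map_zero, ObjectProperty.isoModSerre_zero_iff]
    exact ⟨hM, (torModule k (𝒜 0)).prop_of_isZero hz'⟩
  have h1 : IsIso ((degreeZeroQ 𝒜).map ((grTor 𝒜).isoModSerre.Q.map f)) :=
    (torModule k (𝒜 0)).isoModSerre.Q_inverts _ hf
  have h2 := isIso_of_reflects_iso ((grTor 𝒜).isoModSerre.Q.map f) (degreeZeroQ 𝒜)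
  rw [ObjectProperty.SerreClassLocalization.isIso_map_iff _ (grTor 𝒜),
    ObjectProperty.isoModSerre_zero_iff] at h2
  exact h2.1

end Equivalence

/-! ### Homogeneous submodules and finite generation of components -/

section HomogeneousSpan

variable {k : Type u} {A : Type v} {G : Type w} [Field k] [Ring A] [Algebra k A]
    [AddGroup G] [DecidableEq G] {𝒜 : G → Submodule k A}

namespace GrMod

/-- The `k`-linear map `a ↦ m a`. -/
def orbitMap (M : GrMod 𝒜) (m : M) : A →ₗ[k] M where
  toFun a := op a • m
  map_add' a b := add_smul (op a) (op b) m
  map_smul' c a := smul_assoc c (op a) m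

theorem finiteDimensional_of_component [Finite G] (M : GrMod 𝒜)
    (h : ∀ g, FiniteDimensional k (M.component g)) : FiniteDimensional k M := by
  have h1 : FiniteDimensional k (⨆ g, M.component g : Submodule k M) :=
    Submodule.finite_iSup M.component
  rw [M.isInternal.submodule_iSup_eq_top] at h1
  exact Module.Finite.equiv (Submodule.topEquiv (R := k))

variable [GradedAlgebra 𝒜]

/-- For `m` of degree `g`, distinct homogeneous parts of `a` send `m` to distinct degrees, and only
`a_h` reaches `g + h`. -/
theorem proj_add_smul (M : GrMod 𝒜) {g : G} (h : G) {m : M} (hm : m ∈ M.component g) (a : A) :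
    M.proj (g + h) (op a • m) = op (DirectSum.decompose 𝒜 a h : A) • m := by
  classical
  change M.proj (g + h) (M.orbitMap m a) = M.orbitMap m (DirectSum.decompose 𝒜 a h)
  conv_lhs => rw [← DirectSum.sum_support_decompose 𝒜 a, map_sum, map_sum]
  by_cases hh : h ∈ (DirectSum.decompose 𝒜 a).support
  · rw [Finset.sum_eq_single_of_mem h hh]
    · exact M.proj_self (M.smul_mem hm (DirectSum.decompose 𝒜 a h).2)
    · exact fun j _ hj => M.proj_ne (fun e => hj (add_left_cancel e).symm)
        (M.smul_mem hm (DirectSum.decompose 𝒜 a j).2)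
  · rw [DFinsupp.notMem_support_iff.1 hh, ZeroMemClass.coe_zero, map_zero]
    refine Finset.sum_eq_zero fun j hj => ?_
    exact M.proj_ne (fun e => hh ((add_left_cancel e : h = j) ▸ hj))
      (M.smul_mem hm (DirectSum.decompose 𝒜 a j).2)

theorem proj_mem_span (M : GrMod 𝒜) {s : Set M} (hs : ∀ m ∈ s, ∃ g, m ∈ M.component g)
    (g : G) {x : M} (hx : x ∈ Submodule.span Aᵐᵒᵖ s) :
    M.proj g x ∈ Submodule.span Aᵐᵒᵖ s := by
  induction hx using Submodule.closure_induction with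
  | zero => rw [map_zero]; exact Submodule.zero_mem _
  | add x y _ _ hx hy => rw [map_add]; exact Submodule.add_mem _ hx hy
  | smul_mem a m hm =>
    obtain ⟨h, hh⟩ := hs m hm
    -- With `m` of degree `h`, write `g = h + (-h + g)`, so that `(m a)_g = m a_{-h+g}` stays in the
    -- span.
    rw [← add_neg_cancel_left h g, ← op_unop a, M.proj_add_smul _ hh]
    exact Submodule.smul_mem _ _ (Submodule.subset_span hm)

/-- The graded submodule generated by a set of homogeneous elements. -/
@[reducible] noncomputable def homogeneousSpan (M : GrMod 𝒜) (s : Set M)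
    (hs : ∀ m ∈ s, ∃ g, m ∈ M.component g) : GrMod 𝒜 where
  carrier := Submodule.span Aᵐᵒᵖ s
  component g := (M.component g).comap ((Submodule.span Aᵐᵒᵖ s).subtype.restrictScalars k)
  isInternal := by
    refine isInternal_of_projections _
      (fun g =>
        { toFun := fun x => ⟨M.proj g x.1, M.proj_mem_span hs g x.2⟩
          map_add' := fun x y => Subtype.ext (map_add (M.proj g) x.1 y.1)
          map_smul' := fun c x => Subtype.ext (map_smul (M.proj g) c x.1) })
      (fun g x => M.proj_mem g x.1) (fun g x hx => Subtype.ext (M.proj_self hx))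
      (fun g h hgh x hx => Subtype.ext (M.proj_ne hgh hx)) fun x => ?_
    obtain ⟨s, hs⟩ := M.proj_sum x.1
    exact ⟨s, fun t ht => Subtype.ext (by
      rw [AddSubmonoidClass.coe_finsetSum]; exact hs t ht)⟩
  smul_mem hm ha := M.smul_mem hm ha

/-- The inclusion of a graded submodule. -/
noncomputable def homogeneousSpanι (M : GrMod 𝒜) (s : Set M)
    (hs : ∀ m ∈ s, ∃ g, m ∈ M.component g) : M.homogeneousSpan s hs ⟶ M :=
  homMk (Submodule.span Aᵐᵒᵖ s).subtype fun _ _ h => h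

theorem range_homogeneousSpanι (M : GrMod 𝒜) (s : Set M)
    (hs : ∀ m ∈ s, ∃ g, m ∈ M.component g) :
    LinearMap.range (lin (M.homogeneousSpanι s hs)) = Submodule.span Aᵐᵒᵖ s :=
  Submodule.range_subtype _

/-- The components of a noetherian graded module are finitely generated over `A_e`. -/
theorem exists_finset_component_le (M : GrMod 𝒜) [IsNoetherian Aᵐᵒᵖ M] (g : G) :
    ∃ s : Finset M, (s : Set M) ⊆ M.component g ∧
      M.component g ≤ ⨆ m ∈ s, (𝒜 0).map (M.orbitMap m) := by
  -- The submodule `M_g A` is finitely generated, with generators taken from `M_g`; the degree-`g`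
  -- part of `m a` is then `m a_e`.
  obtain ⟨s, hs, e⟩ := (Submodule.fg_span_iff_fg_span_finset_subset
    (R := Aᵐᵒᵖ) (M.component g : Set M)).1 (IsNoetherian.noetherian _)
  refine ⟨s, hs, fun x hx => ?_⟩
  have hx' : x ∈ Submodule.span Aᵐᵒᵖ (s : Set M) := e ▸ Submodule.subset_span hx
  have key : ∀ y ∈ Submodule.span Aᵐᵒᵖ (s : Set M),
      M.proj g y ∈ ⨆ m ∈ s, (𝒜 0).map (M.orbitMap m) := by
    intro y hy
    induction hy using Submodule.closure_induction with
    | zero => rw [map_zero]; exact Submodule.zero_mem _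
    | add x y _ _ hx hy => rw [map_add]; exact Submodule.add_mem _ hx hy
    | smul_mem a m hm =>
      have := M.proj_add_smul 0 (hs hm) a.unop
      rw [add_zero, op_unop] at this
      rw [this]
      exact Submodule.mem_iSup_of_mem m (Submodule.mem_iSup_of_mem hm
        ⟨_, (DirectSum.decompose 𝒜 a.unop 0).2, rfl⟩)
  rw [← M.proj_self hx]
  exact key x hx'

open scoped ModuleCat in
/-- `M_e` is torsion if and only if `m A_e` is finite dimensional for all `m` in `M_e`. -/
theorem torModule_degreeZero_iff (M : GrMod 𝒜) :
    torModule k (𝒜 0) ((degreeZero 𝒜).obj M) ↔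
      ∀ m ∈ M.component 0, ((𝒜 0).map (M.orbitMap m)).FG := by
  have key (m : (degreeZero 𝒜).obj M) :
      FiniteDimensional k (Submodule.span (𝒜 0)ᵐᵒᵖ {m}) ↔
        ((𝒜 0).map (M.orbitMap (Subtype.val (p := (· ∈ M.component 0)) m))).FG := by
    -- The cyclic module `m A_e` is identified with a `k`-subspace of `M`, so that finiteness can be
    -- tested inside `M`.
    let j : Submodule.span (𝒜 0)ᵐᵒᵖ {m} →ₗ[k]
        (𝒜 0).map (M.orbitMap (Subtype.val (p := (· ∈ M.component 0)) m)) :=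
      { toFun := fun x => ⟨Subtype.val (p := (· ∈ M.component 0)) x.1, by
          obtain ⟨a, ha⟩ := Submodule.mem_span_singleton.1 x.2
          exact ⟨a.unop, a.unop.2, congrArg (Subtype.val (p := (· ∈ M.component 0))) ha⟩⟩
        map_add' := fun x y => rfl
        map_smul' := fun c x => Subtype.ext
          (algebraMap_smul Aᵐᵒᵖ c (Subtype.val (p := (· ∈ M.component 0)) x.1)) }
    have hj : Function.Bijective j := by
      constructor
      · exact fun x y h => Subtype.ext (Subtype.ext
          (congrArg (Subtype.val (p := (· ∈ (𝒜 0).map (M.orbitMap _)))) h))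
      · rintro ⟨_, a, ha, rfl⟩
        exact ⟨⟨op (⟨a, ha⟩ : 𝒜 0) • m, Submodule.smul_mem _ _
          (Submodule.mem_span_singleton_self _)⟩, rfl⟩
    rw [← Module.Finite.iff_fg]
    exact Module.Finite.equiv_iff (LinearEquiv.ofBijective j hj)
  exact ⟨fun h m hm => (key ⟨m, hm⟩).1 (h ⟨m, hm⟩), fun h m => (key m).2 (h _ m.2)⟩

end GrMod

end HomogeneousSpan

/-! ### Detection implies density: the test module `A / A_g A` -/

section RegularModule

variable {k : Type u} {A : Type v} {G : Type w} [Field k] [Ring A] [Algebra k A]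
    [AddGroup G] [DecidableEq G] (𝒜 : G → Submodule k A) [GradedAlgebra 𝒜]

/-- The right module `A`, with its grading shifted by `g`. -/
@[reducible] def GrMod.regularShift (g : G) : GrMod 𝒜 where
  carrier := A
  component h := 𝒜 (g + h)
  isInternal := by
    have h := (DirectSum.isInternal_submodule_iff_iSupIndep_and_iSup_eq_top 𝒜).1
      (DirectSum.Decomposition.isInternal 𝒜)
    refine (DirectSum.isInternal_submodule_iff_iSupIndep_and_iSup_eq_top _).2
      ⟨h.1.comp (add_right_injective g), ?_⟩
    rw [← h.2]
    exact (Equiv.addLeft g).surjective.iSup_comp 𝒜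
  smul_mem {h j m a} hm ha := by
    rw [← add_assoc]
    exact SetLike.mul_mem_graded hm ha

/-- `A_g A ∩ A_e ⊆ A_g A_{g⁻¹}`. -/
theorem mem_mul_of_mem_span {g : G} {a : A} (h0 : a ∈ 𝒜 0)
    (ha : a ∈ Submodule.span Aᵐᵒᵖ (𝒜 g : Set A)) : a ∈ 𝒜 g * 𝒜 (-g) := by
  have key : ∀ x ∈ Submodule.span Aᵐᵒᵖ (𝒜 g : Set A),
      (DirectSum.decompose 𝒜 x 0 : A) ∈ 𝒜 g * 𝒜 (-g) := by
    intro x hx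
    induction hx using Submodule.closure_induction with
    | zero => simp
    | add x y _ _ hx hy =>
      rw [DirectSum.decompose_add]
      exact Submodule.add_mem _ hx hy
    | smul_mem b m hm =>
      -- For `m` in `A_g`, the degree-`e` part of `m b` is `m b_{-g}`.
      have := DirectSum.coe_decompose_mul_add_of_left_mem 𝒜 (j := -g) (b := b.unop) hm
      rw [add_neg_cancel] at this
      change (DirectSum.decompose 𝒜 (m * b.unop) 0 : A) ∈ _
      rw [this]
      exact Submodule.mul_mem_mul hm (DirectSum.decompose 𝒜 b.unop (-g)).2
  have := key a ha
  rwa [DirectSum.decompose_of_mem_same 𝒜 h0] at this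

/-- Detection is applied to `Q = A / A_g A` in the shift where `A_g` has degree `e`: then `Q_e = 0`,
so `Q` is finite dimensional. -/
theorem finiteDimensional_quotient_of_detect
    (H : ∀ M : GrMod 𝒜, Module.Finite Aᵐᵒᵖ M → FiniteDimensional k (M.component 0) →
      FiniteDimensional k M) (g : G) :
    FiniteDimensional k (𝒜 0 ⧸ (𝒜 g * 𝒜 (-g)).submoduleOf (𝒜 0)) := by
  let R := GrMod.regularShift 𝒜 g
  have hs : ∀ m ∈ (𝒜 g : Set A), ∃ h, m ∈ R.component h := fun m hm =>
    ⟨0, by change m ∈ 𝒜 (g + 0); rwa [add_zero]⟩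
  let i := R.homogeneousSpanι (𝒜 g : Set A) hs
  have hi : LinearMap.range (GrMod.lin i) = Submodule.span Aᵐᵒᵖ (𝒜 g : Set A) :=
    R.range_homogeneousSpanι _ hs
  let Q := GrMod.coker i
  have hR : Module.Finite Aᵐᵒᵖ R :=
    Module.Finite.of_surjective (LinearMap.toSpanSingleton Aᵐᵒᵖ A 1) fun a =>
      ⟨op a, one_mul a⟩
  have hQ : Module.Finite Aᵐᵒᵖ Q :=
    Module.Finite.of_surjective (GrMod.lin (GrMod.cokerπ i)) (Submodule.mkQ_surjective _)
  have hQ0 : Q.component 0 = ⊥ := by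
    rw [eq_bot_iff]
    rintro _ ⟨a, ha, rfl⟩
    refine (Submodule.Quotient.mk_eq_zero _).2 ?_
    rw [hi]
    refine Submodule.subset_span ?_
    have : a ∈ 𝒜 (g + 0) := ha
    rwa [add_zero] at this
  have hQfin : FiniteDimensional k Q := H Q hQ (by rw [hQ0]; infer_instance)
  let f : 𝒜 0 →ₗ[k] Q :=
    ((GrMod.lin (GrMod.cokerπ i)).restrictScalars k).comp (𝒜 0).subtype
  -- The kernel of `A_e → Q` is `A_e ∩ A_g A`, so `A_e / A_g A_{g⁻¹}` is a quotient of the image of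
  -- `A_e` in `Q`.
  have hf : LinearMap.ker f ≤ (𝒜 g * 𝒜 (-g)).submoduleOf (𝒜 0) := fun a ha => by
    have h := (Submodule.Quotient.mk_eq_zero (LinearMap.range (GrMod.lin i))).1
      (LinearMap.mem_ker.1 ha)
    rw [hi] at h
    exact mem_mul_of_mem_span 𝒜 a.2 h
  have : FiniteDimensional k (𝒜 0 ⧸ LinearMap.ker f) :=
    Module.Finite.equiv f.quotKerEquivRange.symm
  exact Module.Finite.of_surjective (Submodule.factor hf) (Submodule.factor_surjective hf)

end RegularModule

/-! ### Density implies detection; detection and (T) -/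

section Detect

variable {k : Type u} {A : Type v} {G : Type w} [Field k] [Ring A] [Algebra k A]
    [AddGroup G] [DecidableEq G] (𝒜 : G → Submodule k A) [GradedAlgebra 𝒜]

/-- If `A` is left noetherian, then `A_g` is a finitely generated left `A_e`-module. -/
theorem exists_finset_degreeZero_mul [IsNoetherianRing A] (g : G) :
    ∃ s : Finset A, 𝒜 g ≤ 𝒜 0 * Submodule.span k (s : Set A) := by
  obtain ⟨s, hs, e⟩ := (Submodule.fg_span_iff_fg_span_finset_subset
    (R := A) (𝒜 g : Set A)).1 (IsNoetherian.noetherian _)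
  refine ⟨s, fun x hx => ?_⟩
  have hx' : x ∈ Submodule.span A (s : Set A) := e ▸ Submodule.subset_span hx
  have key : ∀ y ∈ Submodule.span A (s : Set A),
      (DirectSum.decompose 𝒜 y g : A) ∈ 𝒜 0 * Submodule.span k (s : Set A) := by
    intro y hy
    induction hy using Submodule.closure_induction with
    | zero => simp
    | add x y _ _ hx hy =>
      rw [DirectSum.decompose_add]
      exact Submodule.add_mem _ hx hy
    | smul_mem a m hm =>
      -- For `m` in `A_g`, the degree-`g` part of `a m` is `a_e m`.
      have := DirectSum.coe_decompose_mul_add_of_right_mem 𝒜 (i := 0) (a := a) (hs hm)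
      rw [zero_add] at this
      rw [smul_eq_mul, this]
      exact Submodule.mul_mem_mul (DirectSum.decompose 𝒜 a 0).2 (Submodule.subset_span hm)
  have := key x hx'
  rwa [DirectSum.decompose_of_mem_same 𝒜 hx] at this

variable {𝒜}

/-- `M_e A_g` is finite dimensional if `M_e` is. -/
theorem GrMod.exists_fg_degreeZero_smul [IsNoetherianRing A] (M : GrMod 𝒜)
    [FiniteDimensional k (M.component 0)] (g : G) :
    ∃ W : Submodule k M, W.FG ∧ ∀ m ∈ M.component 0, ∀ a ∈ 𝒜 g, op a • m ∈ W := by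
  obtain ⟨s, hs⟩ := exists_finset_degreeZero_mul 𝒜 g
  let B : M →ₗ[k] A →ₗ[k] M := LinearMap.mk₂ k (fun m a => op a • m)
    (fun m n a => smul_add _ _ _) (fun c m a => smul_comm _ _ _)
    (fun m a b => add_smul (op a) (op b) m) (fun c m a => smul_assoc c (op a) m)
  -- Since `A_g` lies in `A_e S` and `M_e A_e` in `M_e`, the space `M_e · span S` contains `M_e
  -- A_g`.
  refine ⟨Submodule.map₂ B (M.component 0) (Submodule.span k s),
    (Module.Finite.iff_fg.1 inferInstance).map₂ B (Submodule.fg_span s.finite_toSet), ?_⟩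
  intro m hm a ha
  refine Submodule.mul_induction_on (hs ha) ?_ ?_
  · intro b hb c hc
    rw [op_mul, mul_smul]
    refine Submodule.apply_mem_map₂ B (m := op b • m) ?_ hc
    have := M.smul_mem hm hb
    rwa [add_zero] at this
  · intro a b ha hb
    rw [MulOpposite.op_add, add_smul]
    exact Submodule.add_mem _ ha hb

/-- A vector space complement of `J ∩ K` in `K` is isomorphic to the quotient and serves as `F`. -/
theorem exists_fg_sup_eq {J K : Submodule k A} [FiniteDimensional k (K ⧸ J.submoduleOf K)] :
    ∃ F : Submodule k A, F.FG ∧ K ≤ J ⊔ F := by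
  obtain ⟨F, hF⟩ := Submodule.exists_isCompl (J.submoduleOf K)
  have : FiniteDimensional k F := Module.Finite.equiv (Submodule.quotientEquivOfIsCompl _ _ hF)
  refine ⟨F.map K.subtype, (Module.Finite.iff_fg.1 this).map _, fun x hx => ?_⟩
  obtain ⟨y, hy, z, hz, e⟩ := Submodule.mem_sup.1 
    (show (⟨x, hx⟩ : K) ∈ J.submoduleOf K ⊔ F from hF.sup_eq_top ▸ Submodule.mem_top)
  exact Submodule.mem_sup.2 ⟨y, hy, z, ⟨z, hz, rfl⟩, congrArg Subtype.val e⟩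

theorem IsDenselyGraded.finiteDimensional [Finite G] [IsNoetherianRing A] [IsNoetherianRing Aᵐᵒᵖ]
    (h : IsDenselyGraded 𝒜) (M : GrMod 𝒜) [Module.Finite Aᵐᵒᵖ M]
    [FiniteDimensional k (M.component 0)] : FiniteDimensional k M := by
  refine M.finiteDimensional_of_component fun g => ?_
  have : IsNoetherian Aᵐᵒᵖ M := isNoetherian_of_isNoetherianRing_of_finite Aᵐᵒᵖ M
  obtain ⟨s, hs, hsg⟩ := M.exists_finset_component_le g
  obtain ⟨W, hW, hWg⟩ := M.exists_fg_degreeZero_smul g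
  -- Density is used at `-g`, which gives the product in the order `A_{g⁻¹} A_g`: from `m` in `M_g`,
  -- the first factor lands in `M_e`.
  have := h.finite_quotient (-g)
  obtain ⟨F, hF, hF0⟩ := exists_fg_sup_eq (J := 𝒜 (-g) * 𝒜 (- -g)) (K := 𝒜 0)
  have hfg : (W ⊔ ⨆ m ∈ s, F.map (M.orbitMap m)).FG :=
    hW.sup (Submodule.fg_biSup _ _ fun m _ => hF.map _)
  have hle : M.component g ≤ W ⊔ ⨆ m ∈ s, F.map (M.orbitMap m) := by
    refine hsg.trans (iSup₂_le fun m hm => ?_)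
    refine (Submodule.map_mono hF0).trans ?_
    rw [Submodule.map_sup]
    refine sup_le_sup ?_ (le_biSup (fun m => F.map (M.orbitMap m)) hm)
    rw [Submodule.map_le_iff_le_comap, Submodule.mul_le]
    intro a ha b hb
    rw [neg_neg] at hb
    change op (a * b) • m ∈ W
    rw [op_mul, mul_smul]
    refine hWg _ ?_ b hb
    have := M.smul_mem (hs hm) ha
    rwa [add_neg_cancel] at this
  have := Module.Finite.iff_fg.2 hfg
  exact Submodule.finiteDimensional_of_le hle

/-- For `m` homogeneous, the degree-`e` part of `N = mA` is finitely generated over `A_e` and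
torsion, hence finite dimensional; detection applied to `N` concludes. -/
theorem grTor_of_detect [IsNoetherianRing Aᵐᵒᵖ]
    (H : ∀ M : GrMod 𝒜, Module.Finite Aᵐᵒᵖ M → FiniteDimensional k (M.component 0) →
      FiniteDimensional k M) (M : GrMod 𝒜)
    (hM : torModule k (𝒜 0) ((degreeZero 𝒜).obj M)) : grTor 𝒜 M := by
  rw [M.torModule_degreeZero_iff] at hM
  intro g m hm
  let N := M.homogeneousSpan {m} (by rintro _ rfl; exact ⟨g, hm⟩)
  have hN : Module.Finite Aᵐᵒᵖ N := Module.Finite.iff_fg.2 (Submodule.fg_span_singleton m)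
  have : IsNoetherian Aᵐᵒᵖ N := isNoetherian_of_isNoetherianRing_of_finite Aᵐᵒᵖ N
  refine H N hN ?_
  obtain ⟨s, hs, hs0⟩ := N.exists_finset_component_le 0
  have hfg : (⨆ x ∈ s, (𝒜 0).map (N.orbitMap x)).FG := by
    refine Submodule.fg_biSup _ _ fun x hx => ?_
    -- The space `x A_e` is measured after the inclusion of `N` in `M`, where the torsion hypothesis
    -- on `M_e` applies.
    refine Submodule.fg_of_fg_map_injective
      ((Submodule.span Aᵐᵒᵖ {m}).subtype.restrictScalars k) Subtype.val_injective ?_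
    rw [← Submodule.map_comp]
    exact hM x.1 (hs hx)
  have := Module.Finite.iff_fg.2 hfg
  exact Submodule.finiteDimensional_of_le hs0

/-- A finite dimensional `M_e` is torsion, so `M` is torsion by (T), and finite generation makes it
finite dimensional. -/
theorem finiteDimensional_of_torModule_le
    (H : ∀ M : GrMod 𝒜, torModule k (𝒜 0) ((degreeZero 𝒜).obj M) → grTor 𝒜 M)
    (M : GrMod 𝒜) [Module.Finite Aᵐᵒᵖ M] [FiniteDimensional k (M.component 0)] :
    FiniteDimensional k M := by
  have hM : grTor 𝒜 M := H M <| M.torModule_degreeZero_iff.2 fun m hm => by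
    refine Module.Finite.iff_fg.1 (Submodule.finiteDimensional_of_le
      (S₂ := M.component 0) ?_)
    rintro _ ⟨a, ha, rfl⟩
    have := M.smul_mem hm ha
    rwa [add_zero] at this
  have := finite_of_fg_of_torsion ((grTor_iff 𝒜 M).1 hM) ⊤ Module.Finite.fg_top
  exact Module.Finite.equiv ((Submodule.topEquiv (R := Aᵐᵒᵖ) (M := M)).restrictScalars k)

end Detect

/-- **Weak Dade's Theorem.** The finite group `G` is written additively (it is not assumed to be
commutative), so that `𝒜 0` is the component `A_e`; `A` is noetherian on both sides, and graded
modules are graded right modules. -/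
theorem mainTheorem2 {k : Type u} {A : Type v} {G : Type w} [Field k] [CharZero k] [Ring A]
    [Algebra k A] [AddGroup G] [Finite G] [DecidableEq G]
    (𝒜 : G → Submodule k A) [GradedAlgebra 𝒜]
    [IsNoetherianRing A] [IsNoetherianRing Aᵐᵒᵖ] :
    List.TFAE [
      IsDenselyGraded 𝒜,
      ∀ M : GrMod 𝒜, Module.Finite Aᵐᵒᵖ M → FiniteDimensional k (M.component 0) →
        FiniteDimensional k M,
      (degreeZeroQ 𝒜).IsEquivalence] := by
  tfae_have 1 → 2 := fun h M _ _ => h.finiteDimensional M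
  -- As `G` is finite, the first clause of density is automatic.
  tfae_have 2 → 1 := fun H => ⟨Set.toFinite _, finiteDimensional_quotient_of_detect 𝒜 H⟩
  tfae_have 2 → 3 := fun H => degreeZeroQ_isEquivalence 𝒜 (grTor_of_detect H)
  tfae_have 3 → 2 := fun _ M _ _ =>
    finiteDimensional_of_torModule_le (grTor_of_degreeZeroQ_isEquivalence 𝒜) M
  tfae_finish
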